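/- Let $X,Y$ be real separable Hilbert spaces with their Borel $\sigma$-algebras (in particular $Y=\mathbb R^J$ is allowed) and let $\mathcal G_a:X\to Y$ be measurable. Let $x\in X$ and $\epsilon,\eta\in Y$ be random variables on a probability space such that $(\epsilon,x)$ is Gaussian on $Y\times X$, $\eta$ is centred Gaussian and $\eta$ is independent of $(\epsilon,x)$, and put $y=\mathcal G_a(x)+\epsilon+\eta$. Write $\bar x,\bar\epsilon$ for the means of $x$ and $\epsilon$; $\mathcal C_x,\mathcal C_\epsilon,\mathcal C_\eta$ for the covariance operators; $\mathcal C_{\epsilon x}=\mathbb E(\epsilon-\bar\epsilon)\otimes(x-\bar x)$, $\mathcal C_{x\epsilon}=\mathbb E(x-\bar x)\otimes(\epsilon-\bar\epsilon)$; $\mu_0=\mathcal N(\bar x,\mathcal C_x)$ for the law of $x$ (the prior) and $\mathbb Q_0=\mathcal N(0,\mathcal C_\eta)$ for the law of $\eta$. For $u\in X$ let $$\bar\nu_u=\bar\epsilon+\mathcal C_{\epsilon x}\mathcal C_x^{-1}(u-\bar x),\qquad \mathcal C_{\nu|x}=\mathcal C_\eta+\mathcal C_\epsilon-\mathcal C_{\epsilon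 x}\mathcal C_x^{-1}\mathcal C_{x\epsilon},\qquad h(u)=\mathcal G_a(u)+\bar\nu_u ,$$ where $\mathcal C_x^{-1}$ is read as the limit of $(\mathcal C_x+\delta I)^{-1}$ as $\delta\downarrow0$: the limit of $u\mapsto \mathcal C_{\epsilon x}(\mathcal C_x+\delta I)^{-1}(u-\bar x)$ is taken in $L^2(\mu_0;Y)$, so that $\bar\nu_u$ is determined for $\mu_0$-a.e. $u$, and that of $\mathcal C_{\epsilon x}(\mathcal C_x+\delta I)^{-1}\mathcal C_{x\epsilon}$ in operator norm. Let $\tilde{\mathbb Q}_u$ be the conditional law of $y$ given $x=u$, and let $\varsigma(du,dy)=\mu_0(du)\tilde{\mathbb Q}_u(dy)$ be the law of $(x,y)$. Assume that $\mathcal C_\eta$ and $\mathcal C_{\nu|x}$ commute, and that there are a complete orthonormal system $(e_k)$ of $Y$ and positive numbers $\lambda_k,r_k$ with $\mathcal C_\eta e_k=\lambda_ke_k$, $\mathcal C_{\nu|x}e_k=r_ke_k$ for all $k$, such that $$\sum_k\frac{\langle h(u),e_k\rangle^2}{\lambda_k+r_k}<\infty\ \text{ for $\mu_0$-a.e. }u,\qquad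 \sum_k\frac{(\lambda_k-r_k)^2}{(\lambda_k+r_k)^2}<\infty .$$ Let $\Phi:X\times Y\to\mathbb R$ be $\mu_0\otimes\mathbb Q_0$-measurable, and let $c:Y\to\mathbb R$ be $\mathbb Q_0$-measurable and positive $\mathbb Q_0$-a.s., such that for $\mu_0$-a.e. $u$ the Radon–Nikodym derivative (of the absolutely continuous part) satisfies $\frac{d\tilde{\mathbb Q}_u}{d\mathbb Q_0}(y)=\frac1{c(y)}e^{-\Phi(u;y)}$ for $\mathbb Q_0$-a.e. $y$. Assume $Z(y):=\int_X e^{-\Phi(u;y)}\mu_0(du)>0$ for $\mathbb Q_0$-a.e. $y$. Then, for $\mu_0$-a.e. $u$, $\tilde{\mathbb Q}_u=\mathcal N(h(u),\mathcal C_{\nu|x})$ and $\tilde{\mathbb Q}_u\ll\mathbb Q_0$. Moreover there is a Markov kernel $y\mapsto\mu^y$ from $Y$ to $X$ which is the conditional distribution of $x$ given $y$ under $\varsigma$ and such that, for $\varsigma$-a.s. $y$, $\mu^y\ll\mu_0$ and $$\frac{d\mu^y}{d\mu_0}(u)=\frac1{Z(y)}\exp(-\Phi(u;y)).\qquad(*)$$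 Suppose in addition that $\Phi$ satisfies the following: (i) for all $a,r>0$ there is $M\in\mathbb R$ with $\Phi(u;y)\ge M-a\|u\|^2$ for all $u\in X$ and all $\|y\|<r$; (ii) there is $p>0$ and for every $r>0$ a $K_1>0$ with $\Phi(u;y)\le K_1(1+\|u\|^p)$ for all $u\in X$ and all $\|y\|<r$; (iii) for every $r>0$ there is $K_2>0$ with $|\Phi(u_1;y)-\Phi(u_2;y)|\le K_2\|u_1-u_2\|$ whenever $\|u_1\|,\|u_2\|,\|y\|<r$; (iv) there is $q\ge0$ and for every $r>0$ a $K_3>0$ with $|\Phi(u;y_1)-\Phi(u;y_2)|\le K_3(1+\|u\|^q)\|y_1-y_2\|$ for all $u\in X$ and all $\|y_1\|,\|y_2\|<r$. Then the kernel can be chosen such that $(*)$ (with $\mu^y\ll\mu_0$) holds for every $y\in Y$, and it is Lipschitz in the data with respect to the Hellinger distance: for every $R>0$ there is $C=C(R)>0$ with $$d_{\mathrm{Hell}}(\mu^y,\mu^{y'})\le C\|y-y'\|\qquad\text{whenever }\|y\|,\|y'\|\le R,$$ where $d_{\mathrm{Hell}}(\mu,\mu')^2=\frac12\int\big(\sqrt{d\mu/d\rho}-\sqrt{d\mu'/d\rho}\big)^2d\rho$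 for a common reference measure $\rho$. -/

import Mathlib

open MeasureTheory ProbabilityTheory Filter Topology
open scoped ENNReal

namespace BayesModelError

noncomputable section

section Covariance

variable {Ω E F : Type*} [MeasurableSpace Ω]
  [NormedAddCommGroup E] [InnerProductSpace ℝ E]
  [NormedAddCommGroup F] [InnerProductSpace ℝ F]

/-- The (centred) covariance operator `C_{VU} = 𝔼 (V - 𝔼 V) ⊗ (U - 𝔼 U) : E → F`, that is
`C_{VU} u = 𝔼 [⟪U - 𝔼 U, u⟫ (V - 𝔼 V)]`, as a Bochner integral of rank-one operators. -/
def crossCov (U : Ω → E) (V : Ω → F) (P : Measure Ω) : E →L[ℝ] F :=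
  ∫ ω, (innerSL ℝ (U ω - ∫ ω', U ω' ∂P)).smulRight (V ω - ∫ ω', V ω' ∂P) ∂P

/-- The covariance operator `C_U = 𝔼 (U - 𝔼 U) ⊗ (U - 𝔼 U)`. -/
def covOp (U : Ω → E) (P : Measure Ω) : E →L[ℝ] E :=
  crossCov U U P

/-- `μ = N(a, C)`: a Gaussian measure with mean `a` and covariance operator `C`. -/
def IsGaussianWith [MeasurableSpace E] (μ : Measure E) (a : E) (C : E →L[ℝ] E) : Prop :=
  IsGaussian μ ∧ ∫ z, z ∂μ = a ∧ covOp (id : E → E) μ = C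

end Covariance

section Conditioning

variable {Ω X Y : Type*} [MeasurableSpace Ω]
  [NormedAddCommGroup X] [InnerProductSpace ℝ X] [MeasurableSpace X]
  [NormedAddCommGroup Y] [InnerProductSpace ℝ Y] [MeasurableSpace Y]

/-- `C_{εx} (C_x + δ I)⁻¹`, the bounded approximation of `C_{εx} C_x⁻¹` (the operator `C_x` is
compact, so that its inverse is unbounded when `X` is infinite dimensional). -/
def gain (x : Ω → X) (ε : Ω → Y) (P : Measure Ω) (δ : ℝ) : X →L[ℝ] Y :=
  crossCov x ε P ∘L Ring.inverse (covOp x P + δ • ContinuousLinearMap.id ℝ X)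

/-- `u ↦ C_{εx} C_x⁻¹ (u - 𝔼 x)` as a measurable function on `X`: the limit in `L²(μ₀; Y)`, with
`μ₀` the law of `x`, of `u ↦ C_{εx} (C_x + δ I)⁻¹ (u - 𝔼 x)` as `δ ↓ 0`. It is determined up to a
`μ₀`-null set. -/
def regression (x : Ω → X) (ε : Ω → Y) (P : Measure Ω) : X → Y :=
  Classical.epsilon fun m : X → Y ↦ Measurable m ∧
    Tendsto (fun δ : ℝ ↦ ∫⁻ u, ‖gain x ε P δ (u - ∫ ω, x ω ∂P) - m u‖ₑ ^ 2 ∂(P.map x))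
      (𝓝[>] 0) (𝓝 0)

/-- The conditional mean `𝔼 ε + C_{εx} C_x⁻¹ (u - 𝔼 x)` of `ε` (and of `ν = ε + η`, for centred
`η`) given `x = u`. -/
def condMean (x : Ω → X) (ε : Ω → Y) (P : Measure Ω) (u : X) : Y :=
  ∫ ω, ε ω ∂P + regression x ε P u

/-- The conditional covariance `C_{ε|x} = C_ε - C_{εx} C_x⁻¹ C_{xε}`, where `C_{εx} C_x⁻¹ C_{xε}`
is the limit, in operator norm, of `C_{εx} (C_x + δ I)⁻¹ C_{xε}` as `δ ↓ 0`. -/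
def condCov (x : Ω → X) (ε : Ω → Y) (P : Measure Ω) : Y →L[ℝ] Y :=
  covOp ε P - limUnder (𝓝[>] (0 : ℝ)) fun δ ↦ gain x ε P δ ∘L crossCov ε x P

/-- `C_{ν|x} = C_η + C_ε - C_{εx} C_x⁻¹ C_{xε}`, the conditional covariance of `ν = ε + η`. -/
def condNoiseCov (x : Ω → X) (ε η : Ω → Y) (P : Measure Ω) : Y →L[ℝ] Y :=
  covOp η P + condCov x ε P

end Conditioning

section Posterior

variable {X Y : Type*} [MeasurableSpace X]

/-- `Z(y) = ∫ exp (-Φ(u; y)) μ₀(du) ∈ [0, ∞]`. -/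
def evidence (Φ : X → Y → ℝ) (μ₀ : Measure X) (y : Y) : ℝ≥0∞ :=
  ∫⁻ u, ENNReal.ofReal (Real.exp (-Φ u y)) ∂μ₀

/-- The posterior measure at the data `y` is absolutely continuous with respect to the prior, with
density `exp (-Φ(u; y)) / Z(y)`. -/
def HasBayesDensity (μ : Measure X) (Φ : X → Y → ℝ) (μ₀ : Measure X) (y : Y) : Prop :=
  μ ≪ μ₀ ∧
    μ.rnDeriv μ₀ =ᵐ[μ₀] fun u ↦ ENNReal.ofReal (Real.exp (-Φ u y)) / evidence Φ μ₀ y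

/-- The Hellinger distance `(½ ∫ (√(dμ/dρ) - √(dμ'/dρ))² dρ) ^ (1/2)`, with the common reference
measure `ρ = μ + μ'`. -/
def hellingerDist (μ μ' : Measure X) : ℝ :=
  Real.sqrt ((1 / 2) * ∫ u, (Real.sqrt ((μ.rnDeriv (μ + μ') u).toReal)
    - Real.sqrt ((μ'.rnDeriv (μ + μ') u).toReal)) ^ 2 ∂(μ + μ'))

end Posterior

/-- The standing assumptions on the potential `Φ`. -/
structure PotentialBounds {X Y : Type*} [NormedAddCommGroup X] [NormedAddCommGroup Y]
    (Φ : X → Y → ℝ) : Prop where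
  lower : ∀ a > (0 : ℝ), ∀ r > (0 : ℝ), ∃ M : ℝ, ∀ (u : X) (y : Y), ‖y‖ < r → M - a * ‖u‖ ^ 2 ≤ Φ u y
  upper : ∃ p > (0 : ℝ), ∀ r > (0 : ℝ), ∃ K > (0 : ℝ), ∀ (u : X) (y : Y), ‖y‖ < r →
    Φ u y ≤ K * (1 + ‖u‖ ^ p)
  lipschitz_state : ∀ r > (0 : ℝ), ∃ K > (0 : ℝ), ∀ (u₁ u₂ : X) (y : Y),
    ‖u₁‖ < r → ‖u₂‖ < r → ‖y‖ < r → |Φ u₁ y - Φ u₂ y| ≤ K * ‖u₁ - u₂‖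
  lipschitz_data : ∃ q ≥ (0 : ℝ), ∀ r > (0 : ℝ), ∃ K > (0 : ℝ), ∀ (u : X) (y₁ y₂ : Y),
    ‖y₁‖ < r → ‖y₂‖ < r → |Φ u y₁ - Φ u y₂| ≤ K * (1 + ‖u‖ ^ q) * ‖y₁ - y₂‖

end

end BayesModelError

/-! Conditional law: attach to an L² variable `f` its score operator `v ↦ ⟪v, f⟫` into real L². With
`A`, `B` the scores of the centred `x`, `ε`, covariances factor as `C_x = A†A` and `C_{εx} = B†A`,
so the regularised regression has scores `A(A†A + δ)⁻¹A† B`. As `δ ↓ 0` the factor in front of `B`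
tends strongly to the projection `Π` onto the closed range of `A`, and since `B` is Hilbert–Schmidt
the convergence holds in mean square. The residual then has scores `(1 - Π)B`: it is uncorrelated
with `x` and has covariance `B†(1 - Π)B = C_{ε|x}`. As a mean-square limit of affine images it is
jointly Gaussian with `x`, hence independent of it, and the law of `y` given `x = u` is that of
`h(u) + residual + η`.

Absolute continuity: the density `exp(-Φ)/c` is positive, so `Q₀ ≪ Q̃_u`. Both measures are Gaussian
with independent coordinates in the basis `e`, so the set carrying the singular part of `Q̃_u`
ignores each single coordinate; by a zero-one law it has mass 0 or 1, and `Q₀ ≪ Q̃_u` excludes 1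
(`absolutelyContinuous_of_absolutelyContinuous_gaussian`).

Posterior: the joint law now has density `exp(-Φ)/c` with respect to `μ₀ ⊗ Q₀`, and Bayes' formula
is Tonelli (`map_swap_eq_compProd_posterior`). For stability, the square root of the posterior
density is the normalised vector `exp(-Φ/2)` of `L²(μ₀)`, so the Hellinger distance is a distance of
unit vectors. Fernique's theorem makes `y ↦ exp(-Φ(·; y)/2)` locally Lipschitz into `L²(μ₀)`, and
the upper bound on `Φ` keeps its norm away from zero. -/

namespace BayesModelError

/-! ### Tikhonov regularisation of orthogonal projections. -/

section Regularisation

variable {H K : Type*} [NormedAddCommGroup H] [InnerProductSpace ℝ H] [CompleteSpace H]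
  [NormedAddCommGroup K] [InnerProductSpace ℝ K] [CompleteSpace K]

open ContinuousLinearMap in
/-- The regularised normal operator `A† A + δ I`. -/
noncomputable def regNormal (A : H →L[ℝ] K) (δ : ℝ) : H →L[ℝ] H :=
  adjoint A ∘L A + δ • ContinuousLinearMap.id ℝ H

open ContinuousLinearMap in
/-- The Tikhonov approximation `A (A† A + δ I)⁻¹ A†` of the orthogonal projection onto the closure
of the range of `A`. -/
noncomputable def regProj (A : H →L[ℝ] K) (δ : ℝ) : K →L[ℝ] K :=
  A ∘L Ring.inverse (regNormal A δ) ∘L adjoint A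

/-- The energy identity: it gives coercivity, hence invertibility for `δ > 0`, and both norm
estimates below. -/
theorem inner_regNormal_self (A : H →L[ℝ] K) (δ : ℝ) (z : H) :
    inner ℝ (regNormal A δ z) z = ‖A z‖ ^ 2 + δ * ‖z‖ ^ 2 := by
  simp only [regNormal, add_apply, ContinuousLinearMap.comp_apply,
    smul_apply, ContinuousLinearMap.id_apply, inner_add_left,
    ContinuousLinearMap.adjoint_inner_left, real_inner_smul_left, real_inner_self_eq_norm_sq]

theorem isUnit_regNormal (A : H →L[ℝ] K) {δ : ℝ} (hδ : 0 < δ) : IsUnit (regNormal A δ) := by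
  refine ContinuousLinearMap.isUnit_of_forall_le_norm_inner_map _ (c := ⟨δ, hδ.le⟩) hδ fun z ↦ ?_
  rw [inner_regNormal_self, Real.norm_of_nonneg (by positivity)]
  change ‖z‖ ^ 2 * δ ≤ _
  nlinarith [sq_nonneg ‖A z‖]

theorem regNormal_inverse_apply (A : H →L[ℝ] K) {δ : ℝ} (hδ : 0 < δ) (w : H) :
    regNormal A δ (Ring.inverse (regNormal A δ) w) = w :=
  congr($(Ring.mul_inverse_cancel _ (isUnit_regNormal A hδ)) w)

theorem inverse_regNormal_apply (A : H →L[ℝ] K) {δ : ℝ} (hδ : 0 < δ) (w : H) :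
    Ring.inverse (regNormal A δ) (regNormal A δ w) = w :=
  congr($(Ring.inverse_mul_cancel _ (isUnit_regNormal A hδ)) w)

theorem adjoint_inverse_regNormal (A : H →L[ℝ] K) (δ : ℝ) :
    ContinuousLinearMap.adjoint (Ring.inverse (regNormal A δ)) = Ring.inverse (regNormal A δ) := by
  have hs : star (regNormal A δ) = regNormal A δ := by
    rw [ContinuousLinearMap.star_eq_adjoint, regNormal, map_add, ContinuousLinearMap.adjoint_comp,
      ContinuousLinearMap.adjoint_adjoint]
    congr 1
    ext1 z
    refine ext_inner_right ℝ fun w ↦ ?_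
    simp [ContinuousLinearMap.adjoint_inner_left, inner_smul_left]
  rw [← ContinuousLinearMap.star_eq_adjoint, ← Ring.inverse_star, hs]

theorem norm_regProj_apply_le (A : H →L[ℝ] K) {δ : ℝ} (hδ : 0 < δ) (f : K) :
    ‖regProj A δ f‖ ≤ ‖f‖ := by
  set z := Ring.inverse (regNormal A δ) (ContinuousLinearMap.adjoint A f) with hz
  have h := inner_regNormal_self A δ z
  rw [hz, regNormal_inverse_apply A hδ, ← hz, ContinuousLinearMap.adjoint_inner_left] at h
  have h2 : inner ℝ f (A z) ≤ ‖f‖ * ‖A z‖ := real_inner_le_norm _ _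
  have h3 : ‖A z‖ ^ 2 ≤ ‖f‖ * ‖A z‖ := by nlinarith [mul_nonneg hδ.le (sq_nonneg ‖z‖)]
  change ‖A z‖ ≤ ‖f‖
  by_contra! hlt
  nlinarith [norm_nonneg f]

/-- Since `A†A = (A†A + δ) - δ`, the error is `-δ A z` with `(A†A + δ) z = w`, and the energy
identity bounds `√δ ‖A z‖` by `‖w‖`. -/
theorem norm_regProj_range_sub_le (A : H →L[ℝ] K) {δ : ℝ} (hδ : 0 < δ) (w : H) :
    ‖regProj A δ (A w) - A w‖ ≤ Real.sqrt δ * ‖w‖ := by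
  set z := Ring.inverse (regNormal A δ) w with hz
  have hN : regNormal A δ z = w := regNormal_inverse_apply A hδ w
  have h1 : regProj A δ (A w) = A w - δ • A z := by
    have : ContinuousLinearMap.adjoint A (A w) = regNormal A δ w - δ • w := by simp [regNormal]
    change A (Ring.inverse (regNormal A δ) (ContinuousLinearMap.adjoint A (A w))) = _
    rw [this, map_sub, inverse_regNormal_apply A hδ, map_smul, map_sub, map_smul]
  have h := inner_regNormal_self A δ z
  rw [hN] at h
  have h2 : inner ℝ w z ≤ ‖w‖ * ‖z‖ := real_inner_le_norm _ _
  have h3 : δ * ‖A z‖ ^ 2 ≤ ‖w‖ ^ 2 := by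
    nlinarith [sq_nonneg (δ * ‖z‖ - ‖w‖), sq_nonneg (δ * ‖z‖), mul_nonneg hδ.le (norm_nonneg z)]
  rw [h1, sub_sub_cancel_left, norm_neg, norm_smul, Real.norm_of_nonneg hδ.le]
  refine abs_le_of_sq_le_sq' ?_ (by positivity) |>.2
  rw [mul_pow, mul_pow, Real.sq_sqrt hδ.le]
  nlinarith

/-- The regularised projections converge strongly to the projection onto the closure of the
range. -/
theorem tendsto_regProj_apply (A : H →L[ℝ] K) (f : K) :
    Tendsto (fun δ ↦ regProj A δ f) (𝓝[>] 0)
      (𝓝 (A.range.topologicalClosure.starProjection f)) := by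
  set V := A.range.topologicalClosure
  -- The rate `√δ` on the range extends to its closure because the operators are contractions
  -- uniformly in `δ`.
  have hrange : ∀ g ∈ V, Tendsto (fun δ ↦ regProj A δ g) (𝓝[>] 0) (𝓝 g) := by
    intro g hg
    rw [Metric.tendsto_nhds]
    intro r hr
    have hg' : g ∈ closure (Set.range A) := by
      simpa [V, ← SetLike.mem_coe, Submodule.topologicalClosure_coe, LinearMap.coe_range] using hg
    obtain ⟨_, ⟨w, rfl⟩, hw⟩ := Metric.mem_closure_iff.1 hg' (r / 3) (by positivity)
    have hsq : Tendsto (fun δ ↦ Real.sqrt δ * ‖w‖) (𝓝[>] 0) (𝓝 0) := by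
      have : Tendsto (fun δ ↦ Real.sqrt δ * ‖w‖) (𝓝 0) (𝓝 (Real.sqrt 0 * ‖w‖)) :=
        (Real.continuous_sqrt.tendsto 0).mul_const _
      simpa using this.mono_left nhdsWithin_le_nhds
    filter_upwards [self_mem_nhdsWithin, hsq.eventually_lt_const (by positivity : 0 < r / 3)]
      with δ hδ hδ'
    have h1 := norm_regProj_apply_le A hδ (g - A w)
    have h2 := norm_regProj_range_sub_le A hδ w
    rw [dist_eq_norm] at hw ⊢
    calc ‖regProj A δ g - g‖
        = ‖regProj A δ (g - A w) + (regProj A δ (A w) - A w) - (g - A w)‖ := by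
          rw [map_sub]; congr 1; abel
      _ ≤ ‖regProj A δ (g - A w)‖ + ‖regProj A δ (A w) - A w‖ + ‖g - A w‖ :=
          (norm_sub_le _ _).trans (by gcongr; exact norm_add_le _ _)
      _ < r := by linarith
  -- The orthogonal complement of the range is the kernel of `A†`.
  have hperp : ∀ δ, regProj A δ (f - V.starProjection f) = 0 := by
    intro δ
    have : ContinuousLinearMap.adjoint A (f - V.starProjection f) = 0 := by
      refine ext_inner_right ℝ fun w ↦ ?_
      rw [ContinuousLinearMap.adjoint_inner_left, inner_zero_left]
      refine Submodule.inner_left_of_mem_orthogonal (K := V) ?_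
        (Submodule.sub_starProjection_mem_orthogonal f)
      exact Submodule.le_topologicalClosure _ ⟨w, rfl⟩
    simp [regProj, this]
  have := hrange _ (Submodule.starProjection_apply_mem V f)
  refine this.congr fun δ ↦ ?_
  have h := hperp δ
  rw [map_sub, sub_eq_zero] at h
  exact h.symm

end Regularisation

/-! ### Score operators and the factorisation of covariances. -/

section Scores

variable {Ω E F ι : Type*} [MeasurableSpace Ω] {P : Measure Ω}
  [NormedAddCommGroup E] [InnerProductSpace ℝ E]
  [NormedAddCommGroup F] [InnerProductSpace ℝ F]

/-- The operator `v ↦ ⟪v, f⟫` from `E` to the real `L²` space attached to `f ∈ L²(P; E)`, as a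
bounded linear function of `f`. -/
noncomputable def scores (P : Measure Ω) : Lp E 2 P →L[ℝ] E →L[ℝ] Lp ℝ 2 P :=
  ((innerSL ℝ : E →L[ℝ] E →L[ℝ] ℝ).compLpL₂ 2 P).flip

theorem scores_apply (f : Lp E 2 P) (v : E) :
    scores P f v = (innerSL ℝ v).compLp f := rfl

theorem scores_apply_ae (f : Lp E 2 P) (v : E) :
    scores P f v =ᵐ[P] fun ω ↦ inner ℝ v (f ω) :=
  ContinuousLinearMap.coeFn_compLp _ _

theorem scores_compLp [CompleteSpace E] [CompleteSpace F] (T : E →L[ℝ] F) (f : Lp E 2 P) :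
    scores P (T.compLp f) = scores P f ∘L ContinuousLinearMap.adjoint T := by
  ext1 v
  refine Lp.ext ?_
  filter_upwards [scores_apply_ae (T.compLp f) v, T.coeFn_compLp f,
    scores_apply_ae f (ContinuousLinearMap.adjoint T v)] with ω h1 h2 h3
  rw [h1, h2, ContinuousLinearMap.comp_apply, h3, ContinuousLinearMap.adjoint_inner_left]

theorem inner_scores (f : Lp E 2 P) (g : Lp F 2 P) (u : E) (v : F) :
    inner ℝ (scores P f u) (scores P g v) = ∫ ω, inner ℝ u (f ω) * inner ℝ v (g ω) ∂P := by
  rw [L2.inner_def]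
  refine integral_congr_ae ?_
  filter_upwards [scores_apply_ae f u, scores_apply_ae g v] with ω h1 h2
  rw [h1, h2, real_inner_eq_re_inner]
  simp [mul_comm]

/-- Orthonormal vectors lie at distance `√2 > 1`, so the balls of radius `1/2` are disjoint.
Countability permits exchanging sum and integral. -/
theorem countable_of_hilbertBasis [TopologicalSpace.SeparableSpace E] (e : HilbertBasis ι ℝ E) :
    Countable ι := by
  have h : (Set.univ : Set ι).PairwiseDisjoint fun k ↦ Metric.ball (e k) (1 / 2) := by
    intro i _ j _ hij
    refine Metric.ball_disjoint_ball ?_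
    have hd : dist (e i) (e j) ^ 2 = 2 := by
      rw [dist_eq_norm, @norm_sub_sq ℝ, e.orthonormal.1 i, e.orthonormal.1 j,
        e.orthonormal.2 hij]
      norm_num
    nlinarith [dist_nonneg (x := e i) (y := e j)]
  exact Set.countable_univ_iff.1
    (h.countable_of_isOpen (fun _ _ ↦ Metric.isOpen_ball)
      fun k _ ↦ ⟨e k, Metric.mem_ball_self (by norm_num)⟩)

theorem hasSum_norm_sq_inner (e : HilbertBasis ι ℝ E) (v : E) :
    HasSum (fun k ↦ inner ℝ (e k) v ^ 2) (‖v‖ ^ 2) := by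
  have h := e.hasSum_inner_mul_inner v v
  rw [real_inner_self_eq_norm_sq] at h
  refine h.congr_fun fun k ↦ ?_
  rw [real_inner_comm v, sq]

/-- Parseval under the integral: the Hilbert–Schmidt norm of the scores is the L² norm, so
mean-square convergence can be checked one basis vector at a time given a summable bound. -/
theorem hasSum_norm_sq_scores [TopologicalSpace.SeparableSpace E] (e : HilbertBasis ι ℝ E)
    (f : Lp E 2 P) : HasSum (fun k ↦ ‖scores P f (e k)‖ ^ 2) (‖f‖ ^ 2) := by
  have := countable_of_hilbertBasis e
  have hk : ∀ k, ‖scores P f (e k)‖ ^ 2 = ∫ ω, inner ℝ (e k) (f ω) ^ 2 ∂P := fun k ↦ by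
    rw [← real_inner_self_eq_norm_sq, inner_scores]
    simp_rw [sq]
  have hf : ‖f‖ ^ 2 = ∫ ω, ‖f ω‖ ^ 2 ∂P := by
    rw [← real_inner_self_eq_norm_sq, L2.inner_def]
    simp_rw [real_inner_self_eq_norm_sq]
  have hint : ∀ k, Integrable (fun ω ↦ inner ℝ (e k) (f ω) ^ 2) P := fun k ↦
    ((Lp.memLp f).const_inner (e k)).integrable_sq
  have hint2 : Integrable (fun ω ↦ ‖f ω‖ ^ 2) P := (Lp.memLp f).integrable_norm_pow (by simp)
  simp_rw [hk, hf]
  have hsum : Summable fun k ↦ ∫ ω, ‖inner ℝ (e k) (f ω) ^ 2‖ ∂P := by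
    refine summable_of_sum_le (c := ∫ ω, ‖f ω‖ ^ 2 ∂P)
      (fun k ↦ integral_nonneg fun ω ↦ norm_nonneg _) fun s ↦ ?_
    rw [← integral_finsetSum _ fun k _ ↦ (hint k).norm]
    refine integral_mono (integrable_finsetSum _ fun k _ ↦ (hint k).norm) hint2 fun ω ↦ ?_
    simp only [Real.norm_of_nonneg (sq_nonneg _)]
    exact sum_le_hasSum s (fun k _ ↦ sq_nonneg _) (hasSum_norm_sq_inner e (f ω))
  have h := hasSum_integral_of_summable_integral_norm hint hsum
  simp_rw [(hasSum_norm_sq_inner e (f _)).tsum_eq] at h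
  exact h

theorem integrable_smulRight_innerSL {f : Ω → E} {g : Ω → F} (hf : MemLp f 2 P)
    (hg : MemLp g 2 P) :
    Integrable (fun ω ↦ (innerSL ℝ (f ω)).smulRight (g ω)) P := by
  have hmeas : AEStronglyMeasurable (fun ω ↦ (innerSL ℝ (f ω)).smulRight (g ω)) P := by
    have hc : Continuous fun p : E × F ↦ (innerSL ℝ p.1).smulRight p.2 :=
      ((ContinuousLinearMap.smulRightL ℝ E F).continuous₂).comp
        (((innerSL ℝ).continuous.comp continuous_fst).prodMk continuous_snd)
    exact hc.comp_aestronglyMeasurable (hf.1.prodMk hg.1)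
  refine (hf.norm.integrable_mul hg.norm).mono' hmeas (ae_of_all _ fun ω ↦ ?_)
  rw [ContinuousLinearMap.norm_smulRight_apply, innerSL_apply_norm]
  rfl

variable [IsProbabilityMeasure P]

/-- The centred random variable `U - 𝔼 U` as an element of `L²`. -/
noncomputable def centred {U : Ω → E} (hU : MemLp U 2 P) : Lp E 2 P :=
  (hU.sub (memLp_const (∫ ω, U ω ∂P))).toLp (fun ω ↦ U ω - ∫ ω', U ω' ∂P)

theorem centred_ae {U : Ω → E} (hU : MemLp U 2 P) :
    centred hU =ᵐ[P] fun ω ↦ U ω - ∫ ω', U ω' ∂P := MemLp.coeFn_toLp _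

theorem crossCov_apply [CompleteSpace F] {U : Ω → E} {V : Ω → F}
    (hU : MemLp U 2 P) (hV : MemLp V 2 P)
    (u : E) (v : F) :
    inner ℝ v (crossCov U V P u) = inner ℝ (scores P (centred hU) u) (scores P (centred hV) v) := by
  rw [inner_scores, crossCov]
  have hint := integrable_smulRight_innerSL (hU.sub (memLp_const (∫ ω, U ω ∂P)))
    (hV.sub (memLp_const (∫ ω, V ω ∂P)))
  have h1 := ContinuousLinearMap.integral_apply hint u
  simp only [Pi.sub_apply] at h1 hint
  rw [h1, ← integral_inner]
  · refine integral_congr_ae ?_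
    filter_upwards [centred_ae hU, centred_ae hV] with ω h2 h3
    rw [h2, h3]
    rw [ContinuousLinearMap.smulRight_apply, innerSL_apply_apply, inner_smul_right,
      real_inner_comm u]
  · exact hint.apply_continuousLinearMap u

/-- This factorisation turns statements about the unbounded `C_x⁻¹` into statements about
projections in L². -/
theorem crossCov_eq [CompleteSpace E] [CompleteSpace F] {U : Ω → E} {V : Ω → F}
    (hU : MemLp U 2 P) (hV : MemLp V 2 P) :
    crossCov U V P
      = ContinuousLinearMap.adjoint (scores P (centred hV)) ∘L scores P (centred hU) := by
  ext1 u
  refine ext_inner_left ℝ fun v ↦ ?_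
  rw [crossCov_apply hU hV, ContinuousLinearMap.comp_apply, ContinuousLinearMap.adjoint_inner_right,
    real_inner_comm]

theorem inner_crossCov [CompleteSpace E] [CompleteSpace F] {U : Ω → E} {V : Ω → F}
    (hU : MemLp U 2 P) (hV : MemLp V 2 P) (u : E) (v : F) :
    inner ℝ v (crossCov U V P u) = cov[fun ω ↦ inner ℝ u (U ω), fun ω ↦ inner ℝ v (V ω); P] := by
  rw [crossCov_apply hU hV, inner_scores, covariance, integral_inner (hU.integrable (by norm_num)),
    integral_inner (hV.integrable (by norm_num))]
  refine integral_congr_ae ?_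
  filter_upwards [centred_ae hU, centred_ae hV] with ω h2 h3
  rw [h2, h3, inner_sub_right, inner_sub_right]

end Scores

/-! ### Mean-square limits of Gaussian variables. -/

section GaussianLimit

variable {Ω E κ : Type*} [MeasurableSpace Ω] {P : Measure Ω} {l : Filter κ}
  [NormedAddCommGroup E] [NormedSpace ℝ E] [MeasurableSpace E] [BorelSpace E]
  [SecondCountableTopology E] [CompleteSpace E]

theorem tendsto_integral_of_tendsto_eLpNorm_two [IsProbabilityMeasure P] {a : κ → Ω → ℝ}
    {b : Ω → ℝ} (ha : ∀ n, MemLp (a n) 2 P) (hb : MemLp b 2 P)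
    (h : Tendsto (fun n ↦ eLpNorm (a n - b) 2 P) l (𝓝 0)) :
    Tendsto (fun n ↦ ∫ ω, a n ω ∂P) l (𝓝 (∫ ω, b ω ∂P)) := by
  refine tendsto_integral_of_L1' b hb.1
    (Eventually.of_forall fun n ↦ (ha n).integrable (by norm_num)) ?_
  exact tendsto_of_tendsto_of_tendsto_of_le_of_le tendsto_const_nhds h (fun _ ↦ zero_le)
    fun n ↦ eLpNorm_le_eLpNorm_of_exponent_le (by norm_num) ((ha n).sub hb).1

theorem tendsto_variance_of_tendsto_eLpNorm_two [IsProbabilityMeasure P] {a : κ → Ω → ℝ}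
    {b : Ω → ℝ} (ha : ∀ n, MemLp (a n) 2 P) (hb : MemLp b 2 P)
    (h : Tendsto (fun n ↦ eLpNorm (a n - b) 2 P) l (𝓝 0)) :
    Tendsto (fun n ↦ Var[a n; P]) l (𝓝 Var[b; P]) := by
  have hmean := tendsto_integral_of_tendsto_eLpNorm_two ha hb h
  have hsq : ∀ {c : Ω → ℝ} (hc : MemLp c 2 P), ∫ ω, (c ^ 2) ω ∂P = ‖hc.toLp c‖ ^ 2 := by
    intro c hc
    rw [← real_inner_self_eq_norm_sq, L2.inner_def]
    refine integral_congr_ae ?_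
    filter_upwards [hc.coeFn_toLp] with ω hω
    rw [hω, real_inner_self_eq_norm_sq, Real.norm_eq_abs, sq_abs, Pi.pow_apply]
  have hlp := (Lp.tendsto_Lp_iff_tendsto_eLpNorm'' a ha b hb).2 h
  rw [variance_eq_sub hb, hsq hb]
  refine Tendsto.congr (fun n ↦ ?_) ((hlp.norm.pow 2).sub (hmean.pow 2))
  rw [variance_eq_sub (ha n), hsq (ha n)]

/-- The map `t ↦ exp(it)` is 1-Lipschitz, so the exponentials converge in L¹. -/
theorem tendsto_integral_exp_of_tendsto_eLpNorm_two [IsProbabilityMeasure P] {a : κ → Ω → ℝ}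
    {b : Ω → ℝ} (ha : ∀ n, MemLp (a n) 2 P) (hb : MemLp b 2 P)
    (h : Tendsto (fun n ↦ eLpNorm (a n - b) 2 P) l (𝓝 0)) :
    Tendsto (fun n ↦ ∫ ω, Complex.exp (a n ω * Complex.I) ∂P) l
      (𝓝 (∫ ω, Complex.exp (b ω * Complex.I) ∂P)) := by
  have hcont : Continuous fun t : ℝ ↦ Complex.exp (t * Complex.I) := by fun_prop
  have hbd : ∀ s t : ℝ, ‖Complex.exp (s * Complex.I) - Complex.exp (t * Complex.I)‖ ≤ ‖s - t‖ := by
    intro s t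
    have : Complex.exp (s * Complex.I) - Complex.exp (t * Complex.I)
        = Complex.exp (t * Complex.I) * (Complex.exp (Complex.I * ((s - t : ℝ) : ℂ)) - 1) := by
      rw [mul_sub, ← Complex.exp_add]
      push_cast
      ring_nf
    rw [this, norm_mul, Complex.norm_exp_ofReal_mul_I, one_mul]
    exact Real.norm_exp_I_mul_ofReal_sub_one_le
  refine tendsto_integral_of_L1' _ (hcont.comp_aestronglyMeasurable hb.1)
    (Eventually.of_forall fun n ↦ ?_) ?_
  · refine (integrable_const (1 : ℝ)).mono' (hcont.comp_aestronglyMeasurable (ha n).1)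
      (ae_of_all _ fun ω ↦ ?_)
    rw [Complex.norm_exp_ofReal_mul_I]
  · refine tendsto_of_tendsto_of_tendsto_of_le_of_le tendsto_const_nhds h (fun _ ↦ zero_le)
      fun n ↦ ?_
    refine (eLpNorm_mono fun ω ↦ ?_).trans
      (eLpNorm_le_eLpNorm_of_exponent_le (by norm_num) ((ha n).sub hb).1)
    exact hbd _ _

/-- Mean-square limits of Gaussian random variables are Gaussian. -/
theorem hasGaussianLaw_of_tendsto_eLpNorm_two [l.NeBot] [IsProbabilityMeasure P] {Z : κ → Ω → E}
    {W : Ω → E} (hZ : ∀ n, HasGaussianLaw (Z n) P) (hW : MemLp W 2 P)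
    (h : Tendsto (fun n ↦ eLpNorm (Z n - W) 2 P) l (𝓝 0)) : HasGaussianLaw W P := by
  have hWm : AEMeasurable W P := hW.1.aemeasurable
  rw [hasGaussianLaw_iff_charFunDual_map_eq hWm]
  intro L
  have hb : MemLp (L ∘ W) 2 P := L.comp_memLp' hW
  have ha : ∀ n, MemLp (L ∘ Z n) 2 P := fun n ↦ ((hZ n).map L).memLp_two
  have hL : Tendsto (fun n ↦ eLpNorm (L ∘ Z n - L ∘ W) 2 P) l (𝓝 0) := by
    have h0 : Tendsto (fun n ↦ ENNReal.ofReal ‖L‖ * eLpNorm (Z n - W) 2 P) l (𝓝 0) := by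
      have h1 := ENNReal.Tendsto.const_mul h (Or.inr (ENNReal.ofReal_ne_top (r := ‖L‖)))
      rwa [mul_zero] at h1
    refine tendsto_of_tendsto_of_tendsto_of_le_of_le tendsto_const_nhds h0 (fun _ ↦ zero_le)
      fun n ↦ ?_
    refine eLpNorm_le_mul_eLpNorm_of_ae_le_mul (ae_of_all _ fun ω ↦ ?_) 2
    simp only [Pi.sub_apply, Function.comp_apply, ← map_sub]
    exact L.le_opNorm _
  have hchar : ∀ {V : Ω → E}, AEMeasurable V P →
      charFunDual (P.map V) L = ∫ ω, Complex.exp (((L ∘ V) ω : ℝ) * Complex.I) ∂P := by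
    intro V hV
    rw [charFunDual_apply, integral_map hV (by fun_prop)]
    rfl
  -- Both sides of the Gaussian formula for the characteristic function pass to the limit, the right
  -- one through mean and variance.
  have h1 := tendsto_integral_exp_of_tendsto_eLpNorm_two ha hb hL
  have h2 : Tendsto (fun n ↦ Complex.exp ((P[L ∘ Z n] : ℝ) * Complex.I - Var[L ∘ Z n; P] / 2)) l
      (𝓝 (Complex.exp ((P[L ∘ W] : ℝ) * Complex.I - Var[L ∘ W; P] / 2))) := by
    have hm := tendsto_integral_of_tendsto_eLpNorm_two ha hb hL
    have hv := tendsto_variance_of_tendsto_eLpNorm_two ha hb hL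
    refine (Complex.continuous_exp.tendsto _).comp (Tendsto.sub ?_ (Tendsto.div_const ?_ _))
    · exact ((Complex.continuous_ofReal.tendsto _).comp hm).mul_const _
    · exact (Complex.continuous_ofReal.tendsto _).comp hv
  rw [hchar hWm]
  refine tendsto_nhds_unique h1 (h2.congr fun n ↦ ?_)
  rw [← (hZ n).charFunDual_map_eq, hchar (hZ n).aemeasurable]

end GaussianLimit

/-! ### The regression of `ε` on `x` and its residual. -/

section Regression

variable {Ω X Y ι : Type*} [MeasurableSpace Ω] {P : Measure Ω} [IsProbabilityMeasure P]
  [NormedAddCommGroup X] [InnerProductSpace ℝ X] [CompleteSpace X]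
  [NormedAddCommGroup Y] [InnerProductSpace ℝ Y] [CompleteSpace Y]
  {x : Ω → X} {ε : Ω → Y}

theorem gain_eq (hx : MemLp x 2 P) (hε : MemLp ε 2 P) (δ : ℝ) :
    gain x ε P δ = ContinuousLinearMap.adjoint (scores P (centred hε)) ∘L scores P (centred hx) ∘L
      Ring.inverse (regNormal (scores P (centred hx)) δ) := by
  rw [gain, covOp, crossCov_eq hx hx, crossCov_eq hx hε]
  rfl

theorem gain_comp_crossCov (hx : MemLp x 2 P) (hε : MemLp ε 2 P) (δ : ℝ) :
    gain x ε P δ ∘L crossCov ε x P = ContinuousLinearMap.adjoint (scores P (centred hε)) ∘L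
      regProj (scores P (centred hx)) δ ∘L scores P (centred hε) := by
  rw [gain_eq hx hε, crossCov_eq hε hx]
  rfl

/-- Taking scores reverses the order of composition, so the regularised projection appears to the
left of the scores of `ε`. -/
theorem scores_gain_compLp (hx : MemLp x 2 P) (hε : MemLp ε 2 P) (δ : ℝ) :
    scores P ((gain x ε P δ).compLp (centred hx))
      = regProj (scores P (centred hx)) δ ∘L scores P (centred hε) := by
  rw [scores_compLp, gain_eq hx hε, ContinuousLinearMap.adjoint_comp,
    ContinuousLinearMap.adjoint_comp, adjoint_inverse_regNormal,
    ContinuousLinearMap.adjoint_adjoint]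
  rfl

/-- The regularised regressions `C_{εx} (C_x + δ I)⁻¹ (x - 𝔼 x)` form a Cauchy family in mean
square as `δ ↓ 0`. -/
theorem cauchy_gain_compLp [TopologicalSpace.SeparableSpace Y] (hx : MemLp x 2 P)
    (hε : MemLp ε 2 P) :
    Cauchy (map (fun δ ↦ (gain x ε P δ).compLp (centred hx)) (𝓝[>] (0 : ℝ))) := by
  obtain ⟨s, e, -⟩ := exists_hilbertBasis ℝ Y
  rw [cauchy_map_iff', tendsto_uniformity_iff_dist_tendsto_zero]
  set A := scores P (centred hx)
  set B := scores P (centred hε)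
  have hsq : ∀ p : ℝ × ℝ, dist ((gain x ε P p.1).compLp (centred hx))
      ((gain x ε P p.2).compLp (centred hx)) ^ 2
        = ∑' k, ‖regProj A p.1 (B (e k)) - regProj A p.2 (B (e k))‖ ^ 2 := by
    intro p
    rw [dist_eq_norm, ← (hasSum_norm_sq_scores e _).tsum_eq]
    simp only [map_sub, scores_gain_compLp hx hε]
    rfl
  have hlim : Tendsto (fun p : ℝ × ℝ ↦
      ∑' k, ‖regProj A p.1 (B (e k)) - regProj A p.2 (B (e k))‖ ^ 2)
      (𝓝[>] 0 ×ˢ 𝓝[>] 0) (𝓝 (∑' _ : s, (0 : ℝ))) := by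
    -- Two contractions give `(2‖B e_k‖)²`, summable because `B` is Hilbert–Schmidt.
    refine tendsto_tsum_of_dominated_convergence (bound := fun k ↦ 4 * ‖B (e k)‖ ^ 2)
      ((hasSum_norm_sq_scores e _).summable.mul_left 4) (fun k ↦ ?_) ?_
    · have h := ((tendsto_regProj_apply A (B (e k))).comp tendsto_fst).sub
        ((tendsto_regProj_apply A (B (e k))).comp (tendsto_snd (f := 𝓝[>] (0 : ℝ))))
      simpa using h.norm.pow 2
    · filter_upwards [prod_mem_prod self_mem_nhdsWithin self_mem_nhdsWithin] with p hp k
      have h1 := norm_regProj_apply_le A hp.1 (B (e k))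
      have h2 := norm_regProj_apply_le A hp.2 (B (e k))
      have h3 := norm_sub_le (regProj A p.1 (B (e k))) (regProj A p.2 (B (e k)))
      rw [Real.norm_of_nonneg (sq_nonneg _)]
      calc _ ≤ (2 * ‖B (e k)‖) ^ 2 := by gcongr; linarith
        _ = _ := by ring
  rw [tsum_zero] at hlim
  have h := (Real.continuous_sqrt.tendsto 0).comp hlim
  rw [Real.sqrt_zero] at h
  refine h.congr fun p ↦ ?_
  rw [Function.comp_apply, ← hsq, Real.sqrt_sq dist_nonneg]

end Regression

theorem lintegral_enorm_sq {α E : Type*} [MeasurableSpace α] [NormedAddCommGroup E]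
    (μ : Measure α) (f : α → E) : ∫⁻ a, ‖f a‖ₑ ^ 2 ∂μ = eLpNorm f 2 μ ^ 2 := by
  have h := eLpNorm_nnreal_pow_eq_lintegral (μ := μ) (f := f) (p := 2) (by norm_num)
  simpa using h.symm

theorem tendsto_lintegral_enorm_sq_iff {α E κ : Type*} [MeasurableSpace α] [NormedAddCommGroup E]
    {μ : Measure α} {l : Filter κ} {f : κ → α → E} :
    Tendsto (fun n ↦ ∫⁻ a, ‖f n a‖ₑ ^ 2 ∂μ) l (𝓝 0) ↔
      Tendsto (fun n ↦ eLpNorm (f n) 2 μ) l (𝓝 0) := by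
  simp_rw [lintegral_enorm_sq]
  constructor
  · intro h
    have h1 := ((ENNReal.continuous_rpow_const (y := (1 / 2 : ℝ))).tendsto 0).comp h
    rw [ENNReal.zero_rpow_of_pos (by norm_num)] at h1
    refine h1.congr fun n ↦ ?_
    rw [Function.comp_apply, ← ENNReal.rpow_natCast, ← ENNReal.rpow_mul]
    norm_num
  · intro h
    simpa using ENNReal.Tendsto.pow (n := 2) h

theorem memLp_prodMk {α E F : Type*} [MeasurableSpace α] [NormedAddCommGroup E]
    [NormedAddCommGroup F] {μ : Measure α} {p : ℝ≥0∞} {f : α → E} {g : α → F} (hf : MemLp f p μ)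
    (hg : MemLp g p μ) : MemLp (fun a ↦ (f a, g a)) p μ := by
  refine (hf.norm.add hg.norm).mono (hf.1.prodMk hg.1) (ae_of_all _ fun a ↦ ?_)
  rw [Prod.norm_mk, Pi.add_apply, Real.norm_of_nonneg (by positivity)]
  exact max_le (le_add_of_nonneg_right (norm_nonneg _)) (le_add_of_nonneg_left (norm_nonneg _))

section Regression

variable {Ω X Y ι : Type*} [MeasurableSpace Ω] {P : Measure Ω} [IsProbabilityMeasure P]
  [NormedAddCommGroup X] [InnerProductSpace ℝ X] [CompleteSpace X]
  [SecondCountableTopology X] [MeasurableSpace X] [BorelSpace X]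
  [NormedAddCommGroup Y] [InnerProductSpace ℝ Y] [CompleteSpace Y]
  [SecondCountableTopology Y] [MeasurableSpace Y] [BorelSpace Y]
  {x : Ω → X} {ε : Ω → Y}

/-- Composition with `x` is an isometry from `L²(μ₀; Y)` into `L²(P; Y)`, so the Cauchy property
pulls back and completeness gives a limit that is a function on `X`. -/
theorem exists_regression (hxm : Measurable x) (hx : MemLp x 2 P) (hε : MemLp ε 2 P) :
    ∃ m : X → Y, Measurable m ∧
      Tendsto (fun δ : ℝ ↦ ∫⁻ u, ‖gain x ε P δ (u - ∫ ω, x ω ∂P) - m u‖ₑ ^ 2 ∂(P.map x))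
        (𝓝[>] 0) (𝓝 0) := by
  have hmp : MeasurePreserving x P (P.map x) := hxm.measurePreserving P
  have : IsProbabilityMeasure (P.map x) := Measure.isProbabilityMeasure_map hxm.aemeasurable
  have hid : MemLp (fun u : X ↦ u) 2 (P.map x) :=
    (memLp_map_measure_iff (by fun_prop) hxm.aemeasurable).2 hx
  have hf : ∀ δ, MemLp (fun u ↦ gain x ε P δ (u - ∫ ω, x ω ∂P)) 2 (P.map x) := fun δ ↦
    (gain x ε P δ).comp_memLp' (hid.sub (memLp_const _))
  have hcomp : ∀ δ, Lp.compMeasurePreserving x hmp ((hf δ).toLp _)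
      = (gain x ε P δ).compLp (centred hx) := by
    intro δ
    rw [Lp.toLp_compMeasurePreserving]
    refine Lp.ext ?_
    filter_upwards [MemLp.coeFn_toLp ((hf δ).comp_measurePreserving hmp),
      (gain x ε P δ).coeFn_compLp (centred hx), centred_ae hx] with ω h1 h2 h3
    rw [h1, h2, h3]
    rfl
  have hcauchy : Cauchy (map (fun δ ↦ (hf δ).toLp _) (𝓝[>] (0 : ℝ))) := by
    rw [← (Lp.isometry_compMeasurePreserving hmp).isUniformInducing.cauchy_map_iff, map_map]
    refine (cauchy_gain_compLp hx hε).mono' ?_ (le_of_eq ?_)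
    · infer_instance
    · exact congrArg (fun g ↦ map g (𝓝[>] (0 : ℝ))) (funext hcomp)
  obtain ⟨W, hW⟩ := cauchy_map_iff_exists_tendsto.1 hcauchy
  refine ⟨W, (Lp.stronglyMeasurable W).measurable, tendsto_lintegral_enorm_sq_iff.2 ?_⟩
  rw [← Lp.toLp_coeFn W (Lp.memLp W)] at hW
  exact (Lp.tendsto_Lp_iff_tendsto_eLpNorm'' _ hf _ (Lp.memLp W)).1 hW

theorem regression_spec (hxm : Measurable x) (hx : MemLp x 2 P) (hε : MemLp ε 2 P) :
    Measurable (regression x ε P) ∧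
      Tendsto (fun δ : ℝ ↦ ∫⁻ u, ‖gain x ε P δ (u - ∫ ω, x ω ∂P) - regression x ε P u‖ₑ ^ 2
        ∂(P.map x)) (𝓝[>] 0) (𝓝 0) :=
  Classical.epsilon_spec (exists_regression hxm hx hε)

theorem tendsto_eLpNorm_regression (hxm : Measurable x) (hx : MemLp x 2 P) (hε : MemLp ε 2 P) :
    Tendsto (fun δ : ℝ ↦ eLpNorm ((fun ω ↦ gain x ε P δ (x ω - ∫ ω, x ω ∂P))
      - fun ω ↦ regression x ε P (x ω)) 2 P) (𝓝[>] 0) (𝓝 0) := by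
  obtain ⟨hm, h⟩ := regression_spec hxm hx hε
  refine (tendsto_lintegral_enorm_sq_iff.1 h).congr fun δ ↦ ?_
  rw [eLpNorm_map_measure (by fun_prop) hxm.aemeasurable]
  rfl

theorem memLp_gain (hx : MemLp x 2 P) (δ : ℝ) :
    MemLp (fun ω ↦ gain x ε P δ (x ω - ∫ ω, x ω ∂P)) 2 P :=
  (gain x ε P δ).comp_memLp' (hx.sub (memLp_const _))

theorem memLp_regression (hxm : Measurable x) (hx : MemLp x 2 P) (hε : MemLp ε 2 P) :
    MemLp (fun ω ↦ regression x ε P (x ω)) 2 P := by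
  obtain ⟨hm, -⟩ := regression_spec hxm hx hε
  obtain ⟨δ, hδ⟩ := ((tendsto_eLpNorm_regression hxm hx hε).eventually_lt_const
    (ENNReal.zero_lt_top)).exists
  have h1 : MemLp ((fun ω ↦ gain x ε P δ (x ω - ∫ ω, x ω ∂P))
      - fun ω ↦ regression x ε P (x ω)) 2 P :=
    ⟨(memLp_gain hx δ).1.sub (hm.comp hxm).aestronglyMeasurable, hδ⟩
  simpa using (memLp_gain (ε := ε) hx δ).sub h1

theorem toLp_gain (hx : MemLp x 2 P) (δ : ℝ) :
    (memLp_gain (ε := ε) hx δ).toLp _ = (gain x ε P δ).compLp (centred hx) := by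
  refine Lp.ext ?_
  filter_upwards [MemLp.coeFn_toLp (memLp_gain (ε := ε) hx δ),
    (gain x ε P δ).coeFn_compLp (centred hx), centred_ae hx] with ω h1 h2 h3
  rw [h1, h2, h3]

theorem tendsto_gain_compLp (hxm : Measurable x) (hx : MemLp x 2 P) (hε : MemLp ε 2 P) :
    Tendsto (fun δ ↦ (gain x ε P δ).compLp (centred hx)) (𝓝[>] (0 : ℝ))
      (𝓝 ((memLp_regression hxm hx hε).toLp _)) := by
  have h := (Lp.tendsto_Lp_iff_tendsto_eLpNorm'' _ (memLp_gain (ε := ε) hx) _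
    (memLp_regression hxm hx hε)).2 (tendsto_eLpNorm_regression hxm hx hε)
  exact h.congr fun δ ↦ toLp_gain hx δ

/-- The regression is the best linear prediction: each coordinate of the centred `ε` is projected
onto the closed span of the coordinates of the centred `x`. -/
theorem scores_regression (hxm : Measurable x) (hx : MemLp x 2 P) (hε : MemLp ε 2 P) :
    scores P ((memLp_regression hxm hx hε).toLp _)
      = (scores P (centred hx)).range.topologicalClosure.starProjection
        ∘L scores P (centred hε) := by
  ext1 v
  have h1 := (((scores P).flip v).continuous.tendsto _).comp (tendsto_gain_compLp hxm hx hε)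
  refine tendsto_nhds_unique h1 ?_
  refine (tendsto_regProj_apply (scores P (centred hx)) (scores P (centred hε) v)).congr
    fun δ ↦ ?_
  simp only [Function.comp_apply, ContinuousLinearMap.flip_apply, scores_gain_compLp hx hε,
    ContinuousLinearMap.comp_apply]

theorem integral_gain (hx : MemLp x 2 P) (δ : ℝ) :
    ∫ ω, gain x ε P δ (x ω - ∫ ω, x ω ∂P) ∂P = 0 := by
  have hi := hx.integrable (by norm_num)
  have hc : Integrable (fun _ : Ω ↦ ∫ ω, x ω ∂P) P := integrable_const _
  have h1 : Integrable (fun ω ↦ x ω - ∫ ω, x ω ∂P) P := hi.sub hc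
  rw [ContinuousLinearMap.integral_comp_comm _ h1, integral_sub hi hc]
  simp

theorem integral_regression (hxm : Measurable x) (hx : MemLp x 2 P) (hε : MemLp ε 2 P) :
    ∫ ω, regression x ε P (x ω) ∂P = 0 := by
  have h := tendsto_integral_of_L1' _ (memLp_regression hxm hx hε).1
    (Eventually.of_forall fun δ ↦ (memLp_gain (ε := ε) hx δ).integrable (by norm_num))
    (tendsto_of_tendsto_of_tendsto_of_le_of_le tendsto_const_nhds
      (tendsto_eLpNorm_regression hxm hx hε) (fun _ ↦ zero_le) fun δ ↦
        eLpNorm_le_eLpNorm_of_exponent_le (by norm_num)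
          ((memLp_gain hx δ).sub (memLp_regression hxm hx hε)).1)
  simp only [integral_gain hx] at h
  exact tendsto_nhds_unique h tendsto_const_nhds

/-- The operator limit `C_{εx} C_x⁻¹ C_{xε}`. -/
theorem tendsto_gain_comp_crossCov (hxm : Measurable x) (hx : MemLp x 2 P) (hε : MemLp ε 2 P) :
    Tendsto (fun δ ↦ gain x ε P δ ∘L crossCov ε x P) (𝓝[>] (0 : ℝ))
      (𝓝 (ContinuousLinearMap.adjoint (scores P (centred hε)) ∘L
        (scores P (centred hx)).range.topologicalClosure.starProjection
          ∘L scores P (centred hε))) := by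
  -- `scores P` is bounded and linear, so mean-square convergence becomes convergence in operator
  -- norm.
  have h := ((scores P).continuous.tendsto _).comp (tendsto_gain_compLp hxm hx hε)
  have h2 := ((ContinuousLinearMap.compL ℝ Y (Lp ℝ 2 P) Y
    (ContinuousLinearMap.adjoint (scores P (centred hε)))).continuous.tendsto _).comp h
  rw [scores_regression hxm hx hε] at h2
  refine h2.congr fun δ ↦ ?_
  rw [gain_comp_crossCov hx hε, Function.comp_apply, Function.comp_apply, scores_gain_compLp hx hε]
  rfl

/-- The residual `ε - 𝔼[ε | x]` of the regression of `ε` on `x`. -/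
noncomputable def residual (x : Ω → X) (ε : Ω → Y) (P : Measure Ω) (ω : Ω) : Y :=
  ε ω - condMean x ε P (x ω)

theorem memLp_condMean (hxm : Measurable x) (hx : MemLp x 2 P) (hε : MemLp ε 2 P) :
    MemLp (fun ω ↦ condMean x ε P (x ω)) 2 P :=
  (memLp_const (∫ ω, ε ω ∂P)).add (memLp_regression hxm hx hε)

theorem memLp_residual (hxm : Measurable x) (hx : MemLp x 2 P) (hε : MemLp ε 2 P) :
    MemLp (residual x ε P) 2 P :=
  hε.sub (memLp_condMean hxm hx hε)

theorem integral_residual (hxm : Measurable x) (hx : MemLp x 2 P) (hε : MemLp ε 2 P) :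
    ∫ ω, residual x ε P ω ∂P = 0 := by
  have hm := (memLp_regression hxm hx hε).integrable (by norm_num)
  have h1 : Integrable (fun _ : Ω ↦ ∫ ω', ε ω' ∂P) P := integrable_const _
  have h2 : ∫ ω, condMean x ε P (x ω) ∂P = ∫ ω, ε ω ∂P := by
    simp only [condMean]
    rw [integral_add h1 hm, integral_regression hxm hx hε]
    simp
  simp only [residual]
  rw [integral_sub (hε.integrable (by norm_num))
    ((memLp_condMean hxm hx hε).integrable (by norm_num)), h2, sub_self]

theorem centred_residual (hxm : Measurable x) (hx : MemLp x 2 P) (hε : MemLp ε 2 P) :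
    centred (memLp_residual hxm hx hε) = centred hε - (memLp_regression hxm hx hε).toLp _ := by
  refine Lp.ext ?_
  filter_upwards [centred_ae (memLp_residual hxm hx hε),
    Lp.coeFn_sub (centred hε) ((memLp_regression hxm hx hε).toLp _), centred_ae hε,
    MemLp.coeFn_toLp (memLp_regression hxm hx hε)] with ω h1 h2 h3 h4
  rw [h1, h2, Pi.sub_apply, h3, h4, integral_residual hxm hx hε, residual, condMean]
  abel

/-- Pythagoras: `((1 - Π)B)†(1 - Π)B = B†B - B†ΠB`. -/
theorem covOp_residual (hxm : Measurable x) (hx : MemLp x 2 P) (hε : MemLp ε 2 P) :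
    covOp (residual x ε P) P = condCov x ε P := by
  rw [condCov, (tendsto_gain_comp_crossCov hxm hx hε).limUnder_eq, covOp, covOp,
    crossCov_eq hε hε, crossCov_eq (memLp_residual hxm hx hε) (memLp_residual hxm hx hε),
    centred_residual hxm hx hε, map_sub, scores_regression hxm hx hε]
  set B := scores P (centred hε)
  set V := (scores P (centred hx)).range.topologicalClosure
  ext1 v
  refine ext_inner_left ℝ fun w ↦ ?_
  simp only [ContinuousLinearMap.comp_apply, sub_apply, inner_sub_right,
    ContinuousLinearMap.adjoint_inner_right]
  have h1 : inner ℝ (V.starProjection (B w)) (B v - V.starProjection (B v)) = 0 :=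
    Submodule.inner_right_of_mem_orthogonal (Submodule.starProjection_apply_mem V _)
      (Submodule.sub_starProjection_mem_orthogonal _)
  rw [inner_sub_right] at h1
  rw [inner_sub_left, inner_sub_left]
  linarith

theorem covariance_residual (hxm : Measurable x) (hx : MemLp x 2 P) (hε : MemLp ε 2 P)
    (v : Y) (u : X) :
    cov[fun ω ↦ inner ℝ v (residual x ε P ω), fun ω ↦ inner ℝ u (x ω); P] = 0 := by
  have hξ := memLp_residual hxm hx hε
  rw [← inner_crossCov hξ hx, crossCov_apply hξ hx, centred_residual hxm hx hε, map_sub,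
    scores_regression hxm hx hε]
  exact Submodule.inner_left_of_mem_orthogonal
    (Submodule.le_topologicalClosure _ (LinearMap.mem_range_self _ _))
    (Submodule.sub_starProjection_mem_orthogonal _)

theorem measurable_residual (hxm : Measurable x) (hεm : Measurable ε) (hx : MemLp x 2 P)
    (hε : MemLp ε 2 P) : Measurable (residual x ε P) :=
  hεm.sub (((regression_spec hxm hx hε).1.comp hxm).const_add _)

/-- For each `δ` the regularised residual paired with `x` is an affine image of `(ε, x)`; the pairs
converge in mean square, the second component being constant in `δ`. -/
theorem hasGaussianLaw_residual (hxm : Measurable x)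
    (h : HasGaussianLaw (fun ω ↦ (ε ω, x ω)) P) :
    HasGaussianLaw (fun ω ↦ (residual x ε P ω, x ω)) P := by
  have hx := h.snd.memLp_two
  have hε := h.fst.memLp_two
  have hlim : Tendsto (fun δ : ℝ ↦ eLpNorm ((fun ω ↦
      ((ε ω - (∫ ω', ε ω' ∂P + gain x ε P δ (x ω - ∫ ω', x ω' ∂P)), x ω) : Y × X))
      - fun ω ↦ (residual x ε P ω, x ω)) 2 P) (𝓝[>] 0) (𝓝 0) := by
    refine (tendsto_eLpNorm_regression hxm hx hε).congr fun δ ↦ ?_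
    refine eLpNorm_congr_norm_ae (ae_of_all _ fun ω ↦ ?_)
    simp only [Pi.sub_apply, Prod.mk_sub_mk, sub_self, Prod.norm_mk, norm_zero, norm_nonneg,
      sup_of_le_left, residual, condMean]
    rw [← norm_neg]
    congr 1
    abel
  refine hasGaussianLaw_of_tendsto_eLpNorm_two (fun δ ↦ ?_)
    (memLp_prodMk (memLp_residual hxm hx hε) hx) hlim
  let T : Y × X →L[ℝ] Y × X :=
    (ContinuousLinearMap.fst ℝ Y X - gain x ε P δ ∘L ContinuousLinearMap.snd ℝ Y X).prod
      (ContinuousLinearMap.snd ℝ Y X)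
  have hT := h.map_fun T
  have hT2 : HasGaussianLaw (fun ω ↦
      T (ε ω, x ω) + ((gain x ε P δ (∫ ω', x ω' ∂P) - ∫ ω', ε ω' ∂P, 0) : Y × X)) P := by
    have := hT.isGaussian_map
    refine ⟨?_⟩
    have h2 : IsGaussian (((P.map fun ω ↦ T (ε ω, x ω)).map fun p ↦
      p + ((gain x ε P δ (∫ ω', x ω' ∂P) - ∫ ω', ε ω' ∂P, 0) : Y × X))) := inferInstance
    rwa [AEMeasurable.map_map_of_aemeasurable (by fun_prop) hT.aemeasurable] at h2
  refine hT2.congr (ae_of_all _ fun ω ↦ ?_)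
  simp only [T, ContinuousLinearMap.prod_apply, sub_apply, ContinuousLinearMap.coe_fst',
    ContinuousLinearMap.comp_apply, ContinuousLinearMap.coe_snd', Prod.mk_add_mk, add_zero, map_sub]
  congr 1
  abel

end Regression

/-! ### The conditional law of the data. -/

section ConditionalLaw

variable {Ω X Y : Type*} [MeasurableSpace Ω] {P : Measure Ω} [IsProbabilityMeasure P]
  [NormedAddCommGroup X] [InnerProductSpace ℝ X] [CompleteSpace X]
  [SecondCountableTopology X] [MeasurableSpace X] [BorelSpace X]
  [NormedAddCommGroup Y] [InnerProductSpace ℝ Y] [CompleteSpace Y]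
  [SecondCountableTopology Y] [MeasurableSpace Y] [BorelSpace Y]
  {x : Ω → X} {ε η : Ω → Y}

theorem covOp_map_id {U : Ω → Y} (hU : Measurable U) :
    covOp (id : Y → Y) (P.map U) = covOp U P := by
  have h : Continuous fun z : Y ↦ (innerSL ℝ (id z - ∫ z', id z' ∂(P.map U))).smulRight
      (id z - ∫ z', id z' ∂(P.map U)) :=
    ((ContinuousLinearMap.smulRightL ℝ Y Y).continuous₂).comp
      (((innerSL ℝ).continuous.comp (continuous_id.sub continuous_const)).prodMk
        (continuous_id.sub continuous_const))
  rw [covOp, covOp, crossCov, integral_map hU.aemeasurable h.aestronglyMeasurable,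
    integral_map hU.aemeasurable aestronglyMeasurable_id]
  rfl

theorem covOp_const_add {U : Ω → Y} (hU : Integrable U P) (a : Y) :
    covOp (fun ω ↦ a + U ω) P = covOp U P := by
  have h : ∫ ω, a + U ω ∂P = a + ∫ ω, U ω ∂P := by
    rw [integral_add (integrable_const _) hU]
    simp
  simp only [covOp, crossCov, h, add_sub_add_left_eq_sub]

theorem covOp_add_of_indepFun {U V : Ω → Y} (hU : MemLp U 2 P) (hV : MemLp V 2 P)
    (h : IndepFun U V P) :
    covOp (fun ω ↦ U ω + V ω) P = covOp U P + covOp V P := by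
  ext1 u
  refine ext_inner_left ℝ fun v ↦ ?_
  have hUV : MemLp (fun ω ↦ U ω + V ω) 2 P := hU.add hV
  have hi : ∀ {W : Ω → Y} (w : Y), MemLp W 2 P → MemLp (fun ω ↦ inner ℝ w (W ω)) 2 P :=
    fun w hW ↦ hW.const_inner w
  have hz : ∀ a b : Y, cov[fun ω ↦ inner ℝ a (U ω), fun ω ↦ inner ℝ b (V ω); P] = 0 := fun a b ↦
    IndepFun.covariance_eq_zero
      (h.comp (φ := fun z ↦ inner ℝ a z) (ψ := fun z ↦ inner ℝ b z) (by fun_prop) (by fun_prop))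
      (hi a hU) (hi b hV)
  have hsum : ∀ w : Y, (fun ω ↦ inner ℝ w (U ω + V ω))
      = (fun ω ↦ inner ℝ w (U ω)) + fun ω ↦ inner ℝ w (V ω) := fun w ↦ by
    ext ω
    exact inner_add_right _ _ _
  rw [add_apply, inner_add_right, covOp, covOp, covOp, inner_crossCov hUV hUV,
    inner_crossCov hU hU, inner_crossCov hV hV, hsum, hsum,
    covariance_add_left (hi _ hU) (hi _ hV) ((hi _ hU).add (hi _ hV)),
    covariance_add_right (hi _ hU) (hi _ hU) (hi _ hV),
    covariance_add_right (hi _ hV) (hi _ hU) (hi _ hV), hz,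
    covariance_comm (fun ω ↦ inner ℝ u (V ω)), hz, add_zero, zero_add,
    covariance_comm (fun ω ↦ inner ℝ u (V ω))]

/-- Given independent `x` and `ζ`, the conditional law of `H(x) + ζ` given `x = u` is the law of
`H(u) + ζ`. -/
theorem condDistrib_add_of_indepFun {ζ y : Ω → Y} {H : X → Y} (hxm : Measurable x)
    (hζm : Measurable ζ) (hH : Measurable H) (hindep : IndepFun x ζ P)
    (hy : ∀ ω, y ω = H (x ω) + ζ ω) :
    ∀ᵐ u ∂(P.map x), condDistrib y x P u = P.map fun ω ↦ H u + ζ ω := by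
  have : IsProbabilityMeasure (P.map ζ) := Measure.isProbabilityMeasure_map hζm.aemeasurable
  have : IsProbabilityMeasure (P.map x) := Measure.isProbabilityMeasure_map hxm.aemeasurable
  have hT : Measurable fun p : X × Y ↦ H p.1 + p.2 := (hH.comp measurable_fst).add measurable_snd
  -- The candidate kernel; that it disintegrates the joint law is Tonelli for the product law of
  -- `(x, ζ)`, and disintegrations are a.e. unique.
  let κ : Kernel X Y := (Kernel.id ×ₖ Kernel.const X (P.map ζ)).map fun p : X × Y ↦ H p.1 + p.2
  have : IsMarkovKernel κ := Kernel.IsMarkovKernel.map _ hT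
  have hym : Measurable y := by
    rw [funext hy]
    exact (hH.comp hxm).add hζm
  have hκ : ∀ u, κ u = P.map fun ω ↦ H u + ζ ω := by
    intro u
    rw [Kernel.map_apply _ hT, Kernel.prod_apply, Kernel.id_apply, Kernel.const_apply,
      Measure.dirac_prod, Measure.map_map hT (by fun_prop), Measure.map_map (by fun_prop) hζm]
    rfl
  have hjoint : P.map (fun ω ↦ (x ω, y ω)) = P.map x ⊗ₘ κ := by
    have h1 := (indepFun_iff_map_prod_eq_prod_map_map hxm.aemeasurable hζm.aemeasurable).1 hindep
    have h2 : P.map (fun ω ↦ (x ω, y ω))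
        = ((P.map x).prod (P.map ζ)).map fun p : X × Y ↦ (p.1, H p.1 + p.2) := by
      rw [← h1, Measure.map_map (measurable_fst.prodMk hT) (hxm.prodMk hζm)]
      simp only [Function.comp_def, hy]
    ext s hs
    rw [h2, Measure.map_apply (measurable_fst.prodMk hT) hs,
      Measure.prod_apply ((measurable_fst.prodMk hT) hs), Measure.compProd_apply hs]
    refine lintegral_congr fun u ↦ ?_
    rw [hκ, Measure.map_apply (hζm.const_add _) (measurable_prodMk_left hs),
      Measure.map_apply hζm (measurable_prodMk_left ((measurable_fst.prodMk hT) hs))]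
    rfl
  filter_upwards [condDistrib_ae_eq_of_measure_eq_compProd x hym.aemeasurable hjoint] with u hu
  rw [hu, hκ]

/-- The conditional law of the data given `x = u` is the Gaussian `N(h(u), C_{ν|x})`. -/
theorem isGaussianWith_condDistrib {y : Ω → Y} {G : X → Y}
    (hx : Measurable x) (hε : Measurable ε) (hη : Measurable η) (hG : Measurable G)
    (hy : ∀ ω, y ω = G (x ω) + ε ω + η ω)
    (hgauss : HasGaussianLaw (fun ω ↦ (ε ω, x ω)) P)
    (hηgauss : HasGaussianLaw η P) (hη0 : ∫ ω, η ω ∂P = 0)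
    (hindep : IndepFun η (fun ω ↦ (ε ω, x ω)) P) :
    ∀ᵐ u ∂(P.map x), IsGaussianWith (condDistrib y x P u) (G u + condMean x ε P u)
      (condNoiseCov x ε η P) := by
  have hx2 := hgauss.snd.memLp_two
  have hε2 := hgauss.fst.memLp_two
  have hη2 := hηgauss.memLp_two
  have hm : Measurable (condMean x ε P) := (regression_spec hx hx2 hε2).1.const_add _
  have hξm := measurable_residual hx hε hx2 hε2
  have hξ2 := memLp_residual hx hx2 hε2
  have hind : IndepFun (fun ω ↦ (residual x ε P ω, x ω)) η P :=
    (hindep.comp (φ := fun z ↦ z) (ψ := fun p : Y × X ↦ (p.1 - condMean x ε P p.2, p.2))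
      measurable_id ((measurable_fst.sub (hm.comp measurable_snd)).prodMk measurable_snd)).symm
  have hξη : IndepFun (residual x ε P) η P := hind.comp (φ := Prod.fst) (ψ := id)
    measurable_fst measurable_id
  have hxη : IndepFun x η P := hind.comp (φ := Prod.snd) (ψ := id) measurable_snd measurable_id
  have hζm : Measurable fun ω ↦ residual x ε P ω + η ω := hξm.add hη
  have hζ2 : MemLp (fun ω ↦ residual x ε P ω + η ω) 2 P := hξ2.add hη2
  have hjoint : HasGaussianLaw (fun ω ↦ (x ω, residual x ε P ω + η ω)) P := by
    have h := (IndepFun.hasGaussianLaw (hasGaussianLaw_residual hx hgauss) hηgauss hind).map_fun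
      (((ContinuousLinearMap.snd ℝ Y X).comp (ContinuousLinearMap.fst ℝ (Y × X) Y)).prod
        ((ContinuousLinearMap.fst ℝ Y X).comp (ContinuousLinearMap.fst ℝ (Y × X) Y)
          + ContinuousLinearMap.snd ℝ (Y × X) Y))
    exact h
  -- Jointly Gaussian and uncorrelated variables are independent.
  have hζindep : IndepFun x (fun ω ↦ residual x ε P ω + η ω) P := by
    refine hjoint.indepFun_of_covariance_inner fun u v ↦ ?_
    have hsum : (fun ω ↦ inner ℝ v (residual x ε P ω + η ω))
        = (fun ω ↦ inner ℝ v (residual x ε P ω)) + fun ω ↦ inner ℝ v (η ω) := by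
      ext ω
      exact inner_add_right _ _ _
    rw [hsum, covariance_add_right (hx2.const_inner u) (hξ2.const_inner v) (hη2.const_inner v),
      covariance_comm, covariance_residual hx hx2 hε2, zero_add]
    exact IndepFun.covariance_eq_zero
      (hxη.comp (φ := fun z ↦ inner ℝ u z) (ψ := fun z ↦ inner ℝ v z) (by fun_prop) (by fun_prop))
      (hx2.const_inner u) (hη2.const_inner v)
  have hcov : covOp (fun ω ↦ residual x ε P ω + η ω) P = condNoiseCov x ε η P := by
    rw [covOp_add_of_indepFun hξ2 hη2 hξη, covOp_residual hx hx2 hε2, condNoiseCov, add_comm]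
  have hmean : ∫ ω, residual x ε P ω + η ω ∂P = 0 := by
    rw [integral_add (hξ2.integrable (by norm_num)) (hη2.integrable (by norm_num)),
      integral_residual hx hx2 hε2, hη0, add_zero]
  have hζg := hjoint.snd
  filter_upwards [condDistrib_add_of_indepFun (y := y) (H := fun u ↦ G u + condMean x ε P u) hx hζm
    (hG.add hm) hζindep fun ω ↦ by rw [hy, residual]; abel] with u hu
  have hcm : Measurable fun ω ↦ G u + condMean x ε P u + (residual x ε P ω + η ω) :=
    hζm.const_add _
  rw [hu]
  refine ⟨?_, ?_, ?_⟩
  · have := hζg.isGaussian_map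
    rw [← Function.comp_def (fun z ↦ G u + condMean x ε P u + z)
      (fun ω ↦ residual x ε P ω + η ω), ← Measure.map_map (by fun_prop) hζm]
    infer_instance
  · rw [integral_map hcm.aemeasurable (by fun_prop),
      integral_add (integrable_const _) (hζ2.integrable (by norm_num)), hmean]
    simp
  · rw [covOp_map_id hcm, covOp_const_add (hζ2.integrable (by norm_num)), hcov]

end ConditionalLaw

/-! ### Sets carrying the singular part of a measure. -/

section LebesgueSet

variable {Y A B : Type*} [MeasurableSpace Y] [MeasurableSpace A] [MeasurableSpace B]

/-- `S` carries the part of `μ` that is singular with respect to `ν`. -/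
structure IsSingularSet (μ ν : Measure Y) (S : Set Y) : Prop where
  measurableSet : MeasurableSet S
  null : ν S = 0
  absolutelyContinuous : μ.restrict Sᶜ ≪ ν

theorem exists_isSingularSet (μ ν : Measure Y) [IsFiniteMeasure μ] [IsFiniteMeasure ν] :
    ∃ S, IsSingularSet μ ν S := by
  obtain ⟨T, hT, h1, h2⟩ := Measure.mutuallySingular_singularPart μ ν
  refine ⟨Tᶜ, hT.compl, h2, ?_⟩
  rw [compl_compl]
  refine Measure.AbsolutelyContinuous.mk fun N hN hN0 ↦ ?_
  rw [Measure.restrict_apply hN]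
  rw [← Measure.singularPart_add_rnDeriv μ ν, Measure.add_apply]
  have h3 : μ.singularPart ν (N ∩ T) = 0 := measure_mono_null Set.inter_subset_right h1
  have h4 : ν.withDensity (μ.rnDeriv ν) (N ∩ T) = 0 :=
    withDensity_absolutelyContinuous _ _ (measure_mono_null Set.inter_subset_left hN0)
  rw [h3, h4, add_zero]

/-- The difference `S \ T` is `ν`-null and lies off `T`, where `μ` is absolutely continuous. -/
theorem IsSingularSet.ae_eq {μ ν : Measure Y} {S T : Set Y} (hS : IsSingularSet μ ν S)
    (hT : IsSingularSet μ ν T) : S =ᵐ[μ] T := by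
  have key : ∀ {S T : Set Y}, IsSingularSet μ ν S → IsSingularSet μ ν T → μ (S \ T) = 0 := by
    intro S T hS hT
    have h := hT.absolutelyContinuous hS.null
    rwa [Measure.restrict_apply hS.measurableSet] at h
  exact ae_eq_set.2 ⟨key hS hT, key hT hS⟩

/-- If `ξ` and `q` are independent under both measures, determine the point, and the law of `ξ`
under `μ` is absolutely continuous, then the singular set is determined by `q`. -/
theorem IsSingularSet.ae_eq_preimage {μ ν : Measure Y} [IsProbabilityMeasure μ]
    [IsProbabilityMeasure ν] {ξ : Y → A} {q : Y → B} {a : A × B → Y} (hξ : Measurable ξ)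
    (hq : Measurable q) (ha : Measurable a) (haq : ∀ z, a (ξ z, q z) = z)
    (hμ : IndepFun ξ q μ) (hν : IndepFun ξ q ν) (hac : μ.map ξ ≪ ν.map ξ)
    {S : Set Y} (hS : IsSingularSet μ ν S) :
    ∃ T : Set B, MeasurableSet T ∧ S =ᵐ[μ] q ⁻¹' T := by
  have := Measure.isProbabilityMeasure_map (μ := μ) hq.aemeasurable
  have := Measure.isProbabilityMeasure_map (μ := ν) hq.aemeasurable
  have := Measure.isProbabilityMeasure_map (μ := μ) hξ.aemeasurable
  have := Measure.isProbabilityMeasure_map (μ := ν) hξ.aemeasurable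
  obtain ⟨T, hT⟩ := exists_isSingularSet (μ.map q) (ν.map q)
  -- With `T` a singular set for the laws of `q`, the set `q ⁻¹' T` is itself a singular set for
  -- `μ`: off it, the law of `(ξ, q)` is a product of absolutely continuous factors. Uniqueness then
  -- applies.
  refine ⟨T, hT.measurableSet, hS.ae_eq ⟨hq hT.measurableSet, ?_, ?_⟩⟩
  · rw [← Measure.map_apply hq hT.measurableSet, hT.null]
  · refine Measure.AbsolutelyContinuous.mk fun N hN hN0 ↦ ?_
    rw [indepFun_iff_map_prod_eq_prod_map_map hξ.aemeasurable hq.aemeasurable] at hμ hν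
    have h1 : ((ν.map ξ).prod (ν.map q)) (a ⁻¹' N) = 0 := by
      rw [← hν, Measure.map_apply (hξ.prodMk hq) (ha hN)]
      simpa [Set.preimage_preimage, haq] using hN0
    have h2 : ((μ.map ξ).prod ((μ.map q).restrict Tᶜ)) (a ⁻¹' N) = 0 :=
      hac.prod hT.absolutelyContinuous h1
    rw [← (μ.map ξ).restrict_univ, Measure.prod_restrict, ← hμ,
      Measure.restrict_apply (ha hN), Measure.map_apply (hξ.prodMk hq)
        ((ha hN).inter (MeasurableSet.univ.prod hT.measurableSet.compl))] at h2
    rw [Measure.restrict_apply hN]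
    convert h2 using 2
    ext z
    simp [haq]

end LebesgueSet

/-! ### Zero-one law and equivalence of Gaussian measures. -/

section Gaussian

variable {Y ι : Type*} [NormedAddCommGroup Y] [InnerProductSpace ℝ Y] [CompleteSpace Y]
  [SecondCountableTopology Y] [MeasurableSpace Y] [BorelSpace Y]
  {e : HilbertBasis ι ℝ Y} {μ ν : Measure Y} {r lam : ι → ℝ}

/-- Removal of the component along the unit vector `v`. -/
noncomputable def removeCoord (v : Y) : Y →L[ℝ] Y :=
  ContinuousLinearMap.id ℝ Y - (innerSL ℝ v).smulRight v

theorem removeCoord_apply (v z : Y) : removeCoord v z = z - inner ℝ v z • v := rfl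

theorem inner_removeCoord (v w z : Y) :
    inner ℝ w (removeCoord v z) = inner ℝ (removeCoord v w) z := by
  simp only [removeCoord_apply, inner_sub_left, inner_sub_right, inner_smul_left, inner_smul_right,
    real_inner_comm w v]
  simp [mul_comm]

theorem covariance_of_covOp [IsGaussian μ] (u v : Y) :
    cov[fun z ↦ inner ℝ u z, fun z ↦ inner ℝ v z; μ]
      = inner ℝ v (covOp (id : Y → Y) μ u) :=
  (inner_crossCov IsGaussian.memLp_two_id IsGaussian.memLp_two_id u v).symm

/-- Along an eigenvector of the covariance the coordinate is uncorrelated with the orthogonal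
remainder, and the two are jointly Gaussian. -/
theorem indepFun_coord [IsGaussian μ] {v : Y} {s : ℝ} (hv : ‖v‖ = 1)
    (hμ : covOp (id : Y → Y) μ v = s • v) :
    IndepFun (fun z ↦ inner ℝ v z) (removeCoord v) μ := by
  have hG : HasGaussianLaw (fun z : Y ↦ ((inner ℝ v z : ℝ), removeCoord v z)) μ :=
    (IsGaussian.hasGaussianLaw_id (μ := μ)).map_fun ((innerSL ℝ v).prod (removeCoord v))
  refine hG.indepFun_of_covariance_inner fun c w ↦ ?_
  have h1 : (fun z : Y ↦ inner ℝ c (inner ℝ v z : ℝ)) = fun z ↦ c * inner ℝ v z := by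
    ext z
    simp [mul_comm]
  simp only [h1, inner_removeCoord]
  rw [covariance_const_mul_left, covariance_of_covOp, hμ, inner_smul_right, removeCoord_apply,
    inner_sub_left, real_inner_smul_left, real_inner_self_eq_norm_sq, hv, real_inner_comm]
  ring

theorem map_coord_eq_gaussianReal [IsGaussian μ] {v : Y} {s : ℝ} (hv : ‖v‖ = 1)
    (hμ : covOp (id : Y → Y) μ v = s • v) :
    μ.map (fun z ↦ inner ℝ v z) = gaussianReal (∫ z, inner ℝ v z ∂μ) s.toNNReal := by
  have hG : HasGaussianLaw (fun z : Y ↦ (inner ℝ v z : ℝ)) μ :=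
    (IsGaussian.hasGaussianLaw_id (μ := μ)).map_fun (innerSL ℝ v)
  rw [hG.map_eq_gaussianReal, ← covariance_self hG.aemeasurable, covariance_of_covOp, hμ,
    inner_smul_right, real_inner_self_eq_norm_sq, hv]
  norm_num

/-- Up to null sets `S` does not see the coordinate along `v`, so the frequency in direction `v`
factors out by independence. -/
theorem charFun_restrict_add_smul [IsGaussian μ] {v : Y} {s : ℝ} (hv : ‖v‖ = 1)
    (hμ : covOp (id : Y → Y) μ v = s • v) {S T : Set Y} (hT : MeasurableSet T)
    (hST : S =ᵐ[μ] removeCoord v ⁻¹' T) {t : Y} (ht : inner ℝ v t = 0) (c : ℝ) :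
    charFun (μ.restrict S) (t + c • v)
      = charFun (μ.map fun z ↦ inner ℝ v z) c * charFun (μ.restrict S) t := by
  have hm : Measurable fun z : Y ↦ (inner ℝ v z : ℝ) := by fun_prop
  have hqT : MeasurableSet (removeCoord v ⁻¹' T) := (removeCoord v).measurable hT
  rw [Measure.restrict_congr_set hST]
  let f : ℝ → ℂ := fun a ↦ Complex.exp (inner ℝ a c * Complex.I)
  let g : Y → ℂ := T.indicator fun b ↦ Complex.exp (inner ℝ b t * Complex.I)
  have hf : Measurable f := by fun_prop
  have hg : Measurable g := Measurable.indicator (by fun_prop) hT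
  have hinner : ∀ z, (inner ℝ (removeCoord v z) t : ℝ) = inner ℝ z t := by
    intro z
    rw [removeCoord_apply, inner_sub_left, real_inner_smul_left, ht, mul_zero, sub_zero]
  have hind := (indepFun_coord hv hμ).comp hf hg
  have h1 := hind.integral_fun_mul_eq_mul_integral
    (hf.comp hm).aestronglyMeasurable (hg.comp (removeCoord v).measurable).aestronglyMeasurable
  have h2 : ∀ z, (g ∘ removeCoord v) z = (removeCoord v ⁻¹' T).indicator
      (fun z ↦ Complex.exp (inner ℝ z t * Complex.I)) z := by
    intro z
    by_cases hz : removeCoord v z ∈ T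
    · simp [g, Set.indicator, hz, hinner]
    · simp [g, Set.indicator, hz]
  have h3 : ∀ z, (f ∘ fun z ↦ inner ℝ v z) z * (g ∘ removeCoord v) z
      = (removeCoord v ⁻¹' T).indicator
        (fun z ↦ Complex.exp (inner ℝ z (t + c • v) * Complex.I)) z := by
    intro z
    rw [h2]
    by_cases hz : z ∈ removeCoord v ⁻¹' T
    · rw [Set.indicator_of_mem hz, Set.indicator_of_mem hz]
      simp only [f, Function.comp_apply]
      rw [← Complex.exp_add, inner_add_right, inner_smul_right, real_inner_comm v z]
      congr 1
      simp
      ring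
    · rw [Set.indicator_of_notMem hz, Set.indicator_of_notMem hz, mul_zero]
  simp only [h3] at h1
  simp only [h2] at h1
  rw [integral_indicator hqT, integral_indicator hqT] at h1
  rw [charFun_apply, charFun_apply, charFun_apply, h1, integral_map hm.aemeasurable (by fun_prop)]
  rfl

/-- Two nondegenerate Gaussian measures with covariances that are diagonal in the same basis: if
`ν ≪ μ` then `μ ≪ ν`. This is the half of the Feldman–Hájek dichotomy that applies once the
measures are known not to be mutually singular; it follows from a zero-one law for the set carrying
the singular part of `μ`. -/
theorem absolutelyContinuous_of_absolutelyContinuous_gaussian [IsGaussian μ] [IsGaussian ν]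
    (hr : ∀ k, 0 < r k) (hlam : ∀ k, 0 < lam k)
    (hμ : ∀ k, covOp (id : Y → Y) μ (e k) = r k • e k)
    (hν : ∀ k, covOp (id : Y → Y) ν (e k) = lam k • e k) (h : ν ≪ μ) : μ ≪ ν := by
  obtain ⟨S, hS⟩ := exists_isSingularSet μ ν
  have he : ∀ k, ‖e k‖ = 1 := e.orthonormal.1
  have hsplit : ∀ k, ∃ T, MeasurableSet T ∧ S =ᵐ[μ] removeCoord (e k) ⁻¹' T := fun k ↦ by
    refine hS.ae_eq_preimage (ξ := fun z ↦ (inner ℝ (e k) z : ℝ))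
      (a := fun p ↦ p.1 • e k + p.2) (by fun_prop)
      (removeCoord (e k)).measurable (by fun_prop) (fun z ↦ ?_) (indepFun_coord (he k) (hμ k))
      (indepFun_coord (he k) (hν k)) ?_
    · simp [removeCoord_apply]
    · rw [map_coord_eq_gaussianReal (he k) (hμ k), map_coord_eq_gaussianReal (he k) (hν k)]
      exact (gaussianReal_absolutelyContinuous _ (by simpa using hr k)).trans
        (gaussianReal_absolutelyContinuous' _ (by simpa using hlam k))
  -- Adding a basis direction multiplies the characteristic functions of `μ.restrict S` and of `μ`
  -- (the case `S = univ`) by the same factor, so their ratio keeps its value `μ(S)` at frequency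
  -- zero.
  have hfin : ∀ (c : ι → ℝ) (s : Finset ι), charFun (μ.restrict S) (∑ k ∈ s, c k • e k)
      = μ.real S * charFun μ (∑ k ∈ s, c k • e k) := by
    classical
    intro c s
    induction s using Finset.induction_on with
    | empty => simp
    | insert j s hj ih =>
      have hperp : inner ℝ (e j) (∑ k ∈ s, c k • e k) = 0 := by
        rw [inner_sum]
        refine Finset.sum_eq_zero fun k hk ↦ ?_
        rw [inner_smul_right, e.orthonormal.2 (by rintro rfl; exact hj hk), mul_zero]
      obtain ⟨T, hT, hST⟩ := hsplit j
      have h1 := charFun_restrict_add_smul (he j) (hμ j) hT hST hperp (c j)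
      have h2 := charFun_restrict_add_smul (he j) (hμ j) (S := Set.univ) (T := Set.univ)
        MeasurableSet.univ (by simp) hperp (c j)
      rw [Measure.restrict_univ] at h2
      rw [Finset.sum_insert hj, add_comm, h1, h2, ih]
      ring
  have hchar : charFun (μ.restrict S) = charFun (μ S • μ) := by
    ext t
    have ht : Tendsto (fun s : Finset ι ↦ ∑ k ∈ s, (e.repr t k : ℝ) • e k) atTop (𝓝 t) :=
      e.hasSum_repr t
    have h1 := ((continuous_charFun (μ := μ.restrict S)).tendsto t).comp ht
    have h2 := (((continuous_charFun (μ := μ)).tendsto t).comp ht).const_mul (μ.real S : ℂ)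
    have h3 : charFun (μ S • μ) t = μ.real S * charFun μ t := by
      rw [charFun_apply, charFun_apply, integral_smul_measure]
      rfl
    rw [h3]
    refine tendsto_nhds_unique h1 (h2.congr fun s ↦ ?_)
    exact (hfin _ s).symm
  have : IsFiniteMeasure (μ S • μ) := ⟨by
    rw [Measure.smul_apply, measure_univ, smul_eq_mul, mul_one]
    exact measure_lt_top _ _⟩
  -- Evaluating `μ.restrict S = μ(S) • μ` at `S` gives `μ(S) = μ(S)²`.
  have hmeas := congrArg (fun m : Measure Y ↦ m S) (Measure.ext_of_charFun hchar)
  simp only [Measure.restrict_apply hS.measurableSet, Set.inter_self, Measure.smul_apply,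
    smul_eq_mul] at hmeas
  by_cases h0 : μ S = 0
  · rw [← Measure.restrict_eq_self_of_ae_mem (s := Sᶜ) (measure_eq_zero_iff_ae_notMem.1 h0)]
    exact hS.absolutelyContinuous
  · have h1 : μ S = 1 := by
      have := ENNReal.mul_right_inj h0 (measure_ne_top μ S) |>.1 (hmeas.symm.trans (mul_one _).symm)
      exact this
    -- If `μ(S) = 1`, then `ν ≪ μ` makes `ν` vanish on `Sᶜ` as well as on `S`.
    have h2 : ν Sᶜ = 0 := h ((prob_compl_eq_zero_iff hS.measurableSet).2 h1)
    rw [prob_compl_eq_zero_iff hS.measurableSet, hS.null] at h2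
    exact absurd h2 zero_ne_one

end Gaussian

/-! ### Bayes' formula. -/

section Posterior

variable {X Y : Type*} [MeasurableSpace X] [MeasurableSpace Y]
  {Φ Ψ : X → Y → ℝ} {μ₀ : Measure X} {Q₀ : Measure Y}

/-- The likelihood `exp (-Φ)` with values in `[0, ∞]`. -/
noncomputable def likelihood (Φ : X → Y → ℝ) (u : X) (y : Y) : ℝ≥0∞ :=
  ENNReal.ofReal (Real.exp (-Φ u y))

theorem measurable_likelihood (hΦ : Measurable (Function.uncurry Φ)) :
    Measurable (Function.uncurry (likelihood Φ)) :=
  (Real.measurable_exp.comp hΦ.neg).ennreal_ofReal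

theorem measurable_likelihood_left (hΦ : Measurable (Function.uncurry Φ)) (y : Y) :
    Measurable fun u ↦ likelihood Φ u y :=
  (measurable_likelihood hΦ).comp measurable_prodMk_right

theorem measurable_evidence [SFinite μ₀] (hΦ : Measurable (Function.uncurry Φ)) :
    Measurable (evidence Φ μ₀) :=
  (measurable_likelihood hΦ).lintegral_prod_left'

/-- The posterior density `exp (-Φ) / Z`. -/
noncomputable def bayesDensity (Φ : X → Y → ℝ) (μ₀ : Measure X) (y : Y) (u : X) : ℝ≥0∞ :=
  likelihood Φ u y / evidence Φ μ₀ y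

theorem measurable_bayesDensity [SFinite μ₀] (hΦ : Measurable (Function.uncurry Φ)) :
    Measurable (Function.uncurry (bayesDensity Φ μ₀)) :=
  ((measurable_likelihood hΦ).comp measurable_swap).div
    ((measurable_evidence hΦ).comp measurable_fst)

theorem measurableSet_evidence_pos_lt_top [SFinite μ₀] (hΦ : Measurable (Function.uncurry Φ)) :
    MeasurableSet {y | 0 < evidence Φ μ₀ y ∧ evidence Φ μ₀ y < ∞} :=
  (measurableSet_lt measurable_const (measurable_evidence hΦ)).inter
    (measurableSet_lt (measurable_evidence hΦ) measurable_const)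

open Classical in
/-- The posterior `y ↦ Z(y)⁻¹ exp (-Φ(·; y)) μ₀`, extended by the prior where `Z(y) ∈ {0, ∞}`. -/
noncomputable def posterior (μ₀ : Measure X) [SFinite μ₀]
    (hΦ : Measurable (Function.uncurry Φ)) : Kernel Y X :=
  Kernel.piecewise (measurableSet_evidence_pos_lt_top (μ₀ := μ₀) hΦ)
    (Kernel.withDensity (Kernel.const Y μ₀) (bayesDensity Φ μ₀)) (Kernel.const Y μ₀)

theorem posterior_apply [SFinite μ₀] (hΦ : Measurable (Function.uncurry Φ)) {y : Y}
    (h0 : 0 < evidence Φ μ₀ y) (h1 : evidence Φ μ₀ y < ∞) :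
    posterior μ₀ hΦ y = μ₀.withDensity (bayesDensity Φ μ₀ y) := by
  rw [posterior, Kernel.piecewise_apply, if_pos ⟨h0, h1⟩,
    Kernel.withDensity_apply _ (measurable_bayesDensity hΦ), Kernel.const_apply]

theorem lintegral_bayesDensity [SFinite μ₀] (hΦ : Measurable (Function.uncurry Φ)) {y : Y}
    (h0 : 0 < evidence Φ μ₀ y) (h1 : evidence Φ μ₀ y < ∞) :
    ∫⁻ u, bayesDensity Φ μ₀ y u ∂μ₀ = 1 := by
  simp only [bayesDensity, ENNReal.div_eq_inv_mul]
  rw [lintegral_const_mul]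
  · exact ENNReal.inv_mul_cancel h0.ne' h1.ne
  · exact measurable_likelihood_left hΦ y

instance isMarkovKernel_posterior [IsProbabilityMeasure μ₀]
    (hΦ : Measurable (Function.uncurry Φ)) : IsMarkovKernel (posterior μ₀ hΦ) := by
  refine ⟨fun y ↦ ?_⟩
  by_cases hy : 0 < evidence Φ μ₀ y ∧ evidence Φ μ₀ y < ∞
  · rw [posterior_apply hΦ hy.1 hy.2]
    refine ⟨?_⟩
    rw [withDensity_apply _ MeasurableSet.univ, Measure.restrict_univ,
      lintegral_bayesDensity hΦ hy.1 hy.2]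
  · have h : posterior μ₀ hΦ y = μ₀ := by
      rw [posterior, Kernel.piecewise_apply]
      exact if_neg hy
    rw [h]
    infer_instance

/-- The kernel is built from a measurable version `Ψ`, while the density is wanted for the given
`Φ`. -/
theorem hasBayesDensity_posterior [IsProbabilityMeasure μ₀]
    (hΨ : Measurable (Function.uncurry Ψ)) {y : Y} (h0 : 0 < evidence Φ μ₀ y)
    (h1 : evidence Φ μ₀ y < ∞) (hΦΨ : ∀ᵐ u ∂μ₀, Φ u y = Ψ u y) :
    HasBayesDensity (posterior μ₀ hΨ y) Φ μ₀ y := by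
  have hZ : evidence Φ μ₀ y = evidence Ψ μ₀ y :=
    lintegral_congr_ae (hΦΨ.mono fun u hu ↦ by simp only [hu])
  rw [HasBayesDensity, posterior_apply hΨ (hZ ▸ h0) (hZ ▸ h1)]
  refine ⟨withDensity_absolutelyContinuous _ _, ?_⟩
  have hm : Measurable (bayesDensity Ψ μ₀ y) :=
    (measurable_bayesDensity hΨ).comp measurable_prodMk_left
  filter_upwards [Measure.rnDeriv_withDensity μ₀ hm, hΦΨ] with u h2 h3
  rw [h2, bayesDensity, likelihood, h3, hZ]

/-- Bayes' formula: if the joint law has density `d(y) exp (-Φ(u; y))` with respect to `μ₀ ⊗ Q₀`,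
then the posterior kernel disintegrates it with respect to the law of the data. -/
theorem map_swap_eq_compProd_posterior [IsProbabilityMeasure μ₀] [IsProbabilityMeasure Q₀]
    (hΦ : Measurable (Function.uncurry Φ)) {d : Y → ℝ≥0∞} (hd : Measurable d)
    (hd0 : ∀ᵐ y ∂Q₀, d y ≠ 0) (hZ : ∀ᵐ y ∂Q₀, 0 < evidence Φ μ₀ y)
    {J : Measure (X × Y)} [IsProbabilityMeasure J]
    (hJ : J = (μ₀.prod Q₀).withDensity fun p ↦ likelihood Φ p.1 p.2 * d p.2) :
    J.map Prod.swap = J.snd ⊗ₘ posterior μ₀ hΦ ∧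
      (∀ᵐ y ∂Q₀, evidence Φ μ₀ y < ∞) := by
  have hlik := measurable_likelihood hΦ
  have hdens : Measurable fun p : X × Y ↦ likelihood Φ p.1 p.2 * d p.2 :=
    hlik.mul (hd.comp measurable_snd)
  have hrect : ∀ (t : Set X) (s : Set Y), MeasurableSet t → MeasurableSet s →
      J (t ×ˢ s) = ∫⁻ y in s, (∫⁻ u in t, likelihood Φ u y ∂μ₀) * d y ∂Q₀ := by
    intro t s ht hs
    rw [hJ, withDensity_apply _ (ht.prod hs), ← Measure.prod_restrict,
      lintegral_prod_symm' _ hdens]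
    refine lintegral_congr fun y ↦ ?_
    exact lintegral_mul_const (d y) (measurable_likelihood_left hΦ y)
  have hsnd : J.snd = Q₀.withDensity fun y ↦ evidence Φ μ₀ y * d y := by
    ext s hs
    rw [Measure.snd_apply hs, withDensity_apply _ hs, ← Set.univ_prod,
      hrect _ _ MeasurableSet.univ hs, Measure.restrict_univ]
    rfl
  have hZd : Measurable fun y ↦ evidence Φ μ₀ y * d y := (measurable_evidence hΦ).mul hd
  -- The density `Z d` of the data has finite mass and `d ≠ 0`, so `Z` cannot be infinite on a set
  -- of positive measure.
  have hfin : ∀ᵐ y ∂Q₀, evidence Φ μ₀ y < ∞ := by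
    have h1 : ∫⁻ y, evidence Φ μ₀ y * d y ∂Q₀ ≠ ∞ := by
      have : J.snd Set.univ ≠ ∞ := measure_ne_top _ _
      rwa [hsnd, withDensity_apply _ MeasurableSet.univ, Measure.restrict_univ] at this
    filter_upwards [ae_lt_top hZd h1, hd0] with y hy hy0
    by_contra hcon
    rw [not_lt, top_le_iff] at hcon
    rw [hcon, ENNReal.top_mul hy0] at hy
    exact lt_irrefl _ hy
  refine ⟨?_, hfin⟩
  have : IsFiniteMeasure (J.map Prod.swap) := inferInstance
  refine Measure.ext_prod fun {s t} hs ht ↦ ?_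
  rw [Measure.map_apply measurable_swap (hs.prod ht), Set.preimage_swap_prod, hrect _ _ ht hs,
    Measure.compProd_apply_prod hs ht, hsnd,
    setLIntegral_withDensity_eq_setLIntegral_mul _ hZd (Kernel.measurable_coe _ ht) hs]
  refine lintegral_congr_ae (ae_restrict_of_ae ?_)
  filter_upwards [hfin, hZ] with y h1 h0
  rw [Pi.mul_apply, posterior_apply hΦ h0 h1, withDensity_apply _ ht]
  simp only [bayesDensity, ENNReal.div_eq_inv_mul]
  rw [lintegral_const_mul _ (measurable_likelihood_left hΦ y), mul_right_comm, ← mul_assoc,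
    ENNReal.mul_inv_cancel h0.ne' h1.ne, one_mul]

theorem compProd_eq_withDensity_prod [IsProbabilityMeasure μ₀] [IsProbabilityMeasure Q₀]
    {κ : Kernel X Y} [IsMarkovKernel κ] {f : X → Y → ℝ≥0∞} (hf : Measurable (Function.uncurry f))
    (hac : ∀ᵐ u ∂μ₀, κ u ≪ Q₀) (hκ : ∀ᵐ u ∂μ₀, (κ u).rnDeriv Q₀ =ᵐ[Q₀] f u) :
    μ₀ ⊗ₘ κ = (μ₀.prod Q₀).withDensity fun p ↦ f p.1 p.2 := by
  have hf' : Measurable fun p : X × Y ↦ f p.1 p.2 := hf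
  ext s hs
  rw [Measure.compProd_apply hs, withDensity_apply _ hs, ← lintegral_indicator hs,
    lintegral_prod _ (hf'.indicator hs).aemeasurable]
  refine lintegral_congr_ae ?_
  filter_upwards [hac, hκ] with u h1 h2
  rw [← Measure.withDensity_rnDeriv_eq _ _ h1, withDensity_congr_ae h2,
    withDensity_apply _ (measurable_prodMk_left hs),
    ← lintegral_indicator (measurable_prodMk_left hs)]
  rfl

end Posterior

/-! ### Change of reference measure in the Hellinger distance. -/

section Hellinger

variable {X : Type*} [MeasurableSpace X]

/-- The Hellinger distance computed with a dominating reference measure. -/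
theorem hellingerDist_eq {μ μ' μ₀ : Measure X} [IsFiniteMeasure μ] [IsFiniteMeasure μ']
    [IsFiniteMeasure μ₀] (hμ : μ ≪ μ₀) (hμ' : μ' ≪ μ₀) :
    hellingerDist μ μ' = Real.sqrt ((1 / 2) * ∫ u, (Real.sqrt ((μ.rnDeriv μ₀ u).toReal)
      - Real.sqrt ((μ'.rnDeriv μ₀ u).toReal)) ^ 2 ∂μ₀) := by
  have hρ : μ + μ' ≪ μ₀ := Measure.AbsolutelyContinuous.add_left hμ hμ'
  have h1 : μ ≪ μ + μ' := Measure.absolutelyContinuous_of_le (Measure.le_add_right le_rfl)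
  have h2 : μ' ≪ μ + μ' := Measure.absolutelyContinuous_of_le (Measure.le_add_left le_rfl)
  rw [hellingerDist, ← integral_rnDeriv_smul hρ]
  congr 2
  refine integral_congr_ae ?_
  -- By the chain rule both densities acquire the factor `dρ/dμ₀`; its square root leaves the
  -- difference and is squared back.
  filter_upwards [Measure.rnDeriv_mul_rnDeriv (κ := μ₀) h1,
    Measure.rnDeriv_mul_rnDeriv (κ := μ₀) h2] with u h3 h4
  rw [← h3, ← h4, Pi.mul_apply, Pi.mul_apply, ENNReal.toReal_mul, ENNReal.toReal_mul,
    Real.sqrt_mul ENNReal.toReal_nonneg, Real.sqrt_mul ENNReal.toReal_nonneg, ← sub_mul, mul_pow,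
    Real.sq_sqrt ENNReal.toReal_nonneg, smul_eq_mul, mul_comm]

end Hellinger

/-! ### Elementary inequalities. -/

section Elementary

/-- One half of the bound comes from `f - g`, the other from the difference of the norms. -/
theorem norm_normalize_sub_le {E : Type*} [NormedAddCommGroup E] [NormedSpace ℝ E] {f g : E}
    (hf : f ≠ 0) (hg : g ≠ 0) : ‖‖f‖⁻¹ • f - ‖g‖⁻¹ • g‖ ≤ 2 * ‖f - g‖ / ‖f‖ := by
  have hf0 : 0 < ‖f‖ := norm_pos_iff.2 hf
  have hg0 : 0 < ‖g‖ := norm_pos_iff.2 hg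
  have h1 : ‖f‖⁻¹ • f - ‖g‖⁻¹ • g = ‖f‖⁻¹ • (f - g) + (‖f‖⁻¹ - ‖g‖⁻¹) • g := by module
  have h2 : ‖(‖f‖⁻¹ - ‖g‖⁻¹) • g‖ = |‖g‖ - ‖f‖| / ‖f‖ := by
    rw [norm_smul, Real.norm_eq_abs, inv_sub_inv hf0.ne' hg0.ne', abs_div, abs_mul,
      abs_of_pos hf0, abs_of_pos hg0]
    field_simp
  rw [h1]
  refine (norm_add_le _ _).trans ?_
  rw [h2, norm_smul, norm_inv, norm_norm]
  have h3 : |‖g‖ - ‖f‖| ≤ ‖f - g‖ := by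
    rw [norm_sub_rev]
    exact abs_norm_sub_norm_le g f
  calc ‖f‖⁻¹ * ‖f - g‖ + |‖g‖ - ‖f‖| / ‖f‖ ≤ ‖f‖⁻¹ * ‖f - g‖ + ‖f - g‖ / ‖f‖ := by gcongr
    _ = 2 * ‖f - g‖ / ‖f‖ := by ring

theorem abs_exp_sub_exp_le {s t m : ℝ} (hs : s ≤ m) (ht : t ≤ m) :
    |Real.exp s - Real.exp t| ≤ Real.exp m * |s - t| := by
  have key : ∀ {s t : ℝ}, s ≤ m → t ≤ s → |Real.exp s - Real.exp t| ≤ Real.exp m * |s - t| := by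
    intro s t hs hts
    rw [abs_of_nonneg (sub_nonneg.2 (Real.exp_le_exp.2 hts)), abs_of_nonneg (sub_nonneg.2 hts)]
    have h1 : Real.exp t = Real.exp s * Real.exp (t - s) := by rw [← Real.exp_add]; ring_nf
    have h2 := Real.add_one_le_exp (t - s)
    have h3 := Real.exp_pos s
    calc Real.exp s - Real.exp t ≤ Real.exp s * (s - t) := by rw [h1]; nlinarith
      _ ≤ Real.exp m * (s - t) := by
        gcongr
  rcases le_total t s with h | h
  · exact key hs h
  · rw [abs_sub_comm, abs_sub_comm s]
    exact key ht h

/-- Powers are dominated by Gaussian exponentials. -/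
theorem exists_one_add_rpow_le_exp_sq {q b : ℝ} (hq : 0 ≤ q) (hb : 0 < b) :
    ∃ D > 0, ∀ t : ℝ, 0 ≤ t → 1 + t ^ q ≤ D * Real.exp (b * t ^ 2) := by
  obtain ⟨n, hn⟩ := exists_nat_ge q
  -- The `2` absorbs the two constants in `1 + t ^ q ≤ 2 + t ^ (2n)`; the quotient comes from the
  -- `n`-th term of the exponential series.
  refine ⟨2 + n.factorial / b ^ n, by positivity, fun t ht ↦ ?_⟩
  have h1 : t ^ q ≤ 1 + (t ^ 2) ^ n := by
    rcases le_total t 1 with h | h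
    · exact (Real.rpow_le_one ht h hq).trans (le_add_of_nonneg_right (by positivity))
    · have h2 : t ^ q ≤ t ^ (n : ℝ) := Real.rpow_le_rpow_of_exponent_le h hn
      rw [Real.rpow_natCast] at h2
      have h3 : t ^ n ≤ (t ^ 2) ^ n := pow_le_pow_left₀ ht (by nlinarith) n
      linarith
  have h2 := Real.pow_div_factorial_le_exp (b * t ^ 2) (by positivity) n
  have h3 : (t ^ 2) ^ n ≤ n.factorial / b ^ n * Real.exp (b * t ^ 2) := by
    rw [mul_pow, div_le_iff₀ (by positivity)] at h2
    rw [div_mul_eq_mul_div, le_div_iff₀ (by positivity)]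
    linarith
  have h4 : 1 ≤ Real.exp (b * t ^ 2) := Real.one_le_exp (by positivity)
  linarith

end Elementary

/-! ### Potentials with the standing bounds and Lipschitz dependence on the data. -/

section Bounds

variable {X Y : Type*} [NormedAddCommGroup X] [NormedAddCommGroup Y] {Φ : X → Y → ℝ}

/-- The path through `(u₀, y)` uses one Lipschitz bound per leg. Joint continuity makes `Φ` itself
Borel measurable. -/
theorem PotentialBounds.continuous (h : PotentialBounds Φ) : Continuous (Function.uncurry Φ) := by
  rw [continuous_iff_continuousAt]
  rintro ⟨u₀, y₀⟩
  obtain ⟨q, -, hq⟩ := h.lipschitz_data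
  set R : ℝ := ‖u₀‖ + ‖y₀‖ + 1 with hR
  have hRpos : 0 < R := by positivity
  obtain ⟨K₂, -, hK₂⟩ := h.lipschitz_state R hRpos
  obtain ⟨K₃, -, hK₃⟩ := hq R hRpos
  have hu₀ : ‖u₀‖ < R := by linarith [norm_nonneg y₀]
  have hy₀ : ‖y₀‖ < R := by linarith [norm_nonneg u₀]
  rw [ContinuousAt, tendsto_iff_norm_sub_tendsto_zero]
  refine squeeze_zero' (g := fun p : X × Y ↦
    K₂ * ‖p.1 - u₀‖ + K₃ * (1 + ‖u₀‖ ^ q) * ‖p.2 - y₀‖)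
    (Eventually.of_forall fun _ ↦ norm_nonneg _) ?_ ?_
  · have h1 : ∀ᶠ p : X × Y in 𝓝 (u₀, y₀), ‖p.1‖ < R :=
      (continuous_fst.norm.tendsto (u₀, y₀)).eventually_lt_const hu₀
    have h2 : ∀ᶠ p : X × Y in 𝓝 (u₀, y₀), ‖p.2‖ < R :=
      (continuous_snd.norm.tendsto (u₀, y₀)).eventually_lt_const hy₀
    filter_upwards [h1, h2] with p hp1 hp2
    calc ‖Φ p.1 p.2 - Φ u₀ y₀‖
        ≤ |Φ p.1 p.2 - Φ u₀ p.2| + |Φ u₀ p.2 - Φ u₀ y₀| := abs_sub_le _ _ _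
      _ ≤ _ := add_le_add (hK₂ _ _ _ hp1 hu₀ hp2) (hK₃ _ _ _ hp2 hy₀)
  · have hc : Continuous fun p : X × Y ↦
        K₂ * ‖p.1 - u₀‖ + K₃ * (1 + ‖u₀‖ ^ q) * ‖p.2 - y₀‖ := by fun_prop
    simpa using hc.tendsto (u₀, y₀)

variable [MeasurableSpace X] [BorelSpace X] [SecondCountableTopology X] {μ₀ : Measure X}

theorem PotentialBounds.measurable_left (h : PotentialBounds Φ) (y : Y) :
    Measurable fun u ↦ Φ u y :=
  (h.continuous.comp (continuous_id.prodMk continuous_const)).measurable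

variable [NormedSpace ℝ X] [CompleteSpace X] [IsGaussian μ₀]

theorem memLp_two_of_abs_le_exp_sq {f : X → ℝ} (hf : AEStronglyMeasurable f μ₀) {D C : ℝ}
    (hint : Integrable (fun u ↦ Real.exp (C * ‖u‖ ^ 2)) μ₀)
    (h : ∀ u, |f u| ≤ D * Real.exp (C / 2 * ‖u‖ ^ 2)) : MemLp f 2 μ₀ := by
  rw [memLp_two_iff_integrable_sq hf]
  refine (hint.const_mul (D ^ 2)).mono' (hf.pow 2) (ae_of_all _ fun u ↦ ?_)
  rw [Real.norm_of_nonneg (sq_nonneg _), ← sq_abs]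
  calc |f u| ^ 2 ≤ (D * Real.exp (C / 2 * ‖u‖ ^ 2)) ^ 2 := by
        gcongr
        exact h u
    _ = D ^ 2 * Real.exp (C * ‖u‖ ^ 2) := by
        rw [mul_pow, ← Real.exp_nat_mul]
        congr 2
        push_cast
        ring

/-- The square root `exp (-Φ / 2)` of the likelihood is square integrable with respect to a
Gaussian measure. -/
theorem PotentialBounds.memLp_exp (h : PotentialBounds Φ) (y : Y) :
    MemLp (fun u ↦ Real.exp (-Φ u y / 2)) 2 μ₀ := by
  -- Fernique's exponent `C` fixes the `a` of the lower bound: then `exp(-Φ/2)` is at most a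
  -- constant times `exp(C‖u‖²/2)`.
  obtain ⟨C, hC, hint⟩ := IsGaussian.exists_integrable_exp_sq μ₀
  obtain ⟨M, hM⟩ := h.lower C hC (‖y‖ + 1) (by positivity)
  have hm : Measurable fun u ↦ Real.exp (-Φ u y / 2) :=
    Real.measurable_exp.comp ((h.measurable_left y).neg.div_const 2)
  refine memLp_two_of_abs_le_exp_sq (D := Real.exp (-M / 2)) hm.aestronglyMeasurable hint
    fun u ↦ ?_
  rw [Real.abs_exp, ← Real.exp_add, Real.exp_le_exp]
  linarith [hM u y (lt_add_one _)]

/-- `exp (-Φ(·; y) / 2)` as an element of `L²(μ₀)`. -/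
noncomputable def PotentialBounds.sqrtLikelihood (h : PotentialBounds Φ) (μ₀ : Measure X)
    [IsGaussian μ₀] (y : Y) : Lp ℝ 2 μ₀ :=
  (h.memLp_exp (μ₀ := μ₀) y).toLp _

theorem PotentialBounds.sqrtLikelihood_ae (h : PotentialBounds Φ) (y : Y) :
    h.sqrtLikelihood μ₀ y =ᵐ[μ₀] fun u ↦ Real.exp (-Φ u y / 2) :=
  MemLp.coeFn_toLp _

theorem exp_half_sq (a : ℝ) : Real.exp (a / 2) ^ 2 = Real.exp a := by
  rw [← Real.exp_nat_mul]
  congr 1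
  push_cast
  ring

/-- Makes dividing the likelihood by `Z` the same as normalising its square root in `L²(μ₀)`. -/
theorem PotentialBounds.evidence_eq (h : PotentialBounds Φ) (y : Y) :
    evidence Φ μ₀ y = ENNReal.ofReal (‖h.sqrtLikelihood μ₀ y‖ ^ 2) := by
  have hint : Integrable (fun u ↦ Real.exp (-Φ u y)) μ₀ := by
    simpa only [exp_half_sq] using (h.memLp_exp (μ₀ := μ₀) y).integrable_sq
  rw [evidence, ← ofReal_integral_eq_lintegral_ofReal hint
    (ae_of_all _ fun u ↦ (Real.exp_pos _).le), ← real_inner_self_eq_norm_sq, L2.inner_def]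
  congr 1
  refine integral_congr_ae ?_
  filter_upwards [h.sqrtLikelihood_ae (μ₀ := μ₀) y] with u hu
  rw [hu, real_inner_self_eq_norm_sq, Real.norm_eq_abs, sq_abs, exp_half_sq]

theorem PotentialBounds.evidence_lt_top (h : PotentialBounds Φ) (y : Y) :
    evidence Φ μ₀ y < ∞ := by
  rw [h.evidence_eq]
  exact ENNReal.ofReal_lt_top

/-- The evidence is bounded below on bounded sets of data. -/
theorem PotentialBounds.exists_le_norm_sqrtLikelihood (h : PotentialBounds Φ) (R : ℝ) :
    ∃ κ > 0, ∀ y, ‖y‖ ≤ R → κ ≤ ‖h.sqrtLikelihood μ₀ y‖ := by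
  obtain ⟨p, hp, hup⟩ := h.upper
  obtain ⟨K, hK, hKup⟩ := hup (|R| + 1) (by positivity)
  have hm : Measurable fun u : X ↦ ENNReal.ofReal (Real.exp (-(K * (1 + ‖u‖ ^ p)))) := by
    fun_prop
  -- A lower bound for the evidence that does not depend on `y`; it is positive because the
  -- integrand is positive everywhere.
  set I := ∫⁻ u, ENNReal.ofReal (Real.exp (-(K * (1 + ‖u‖ ^ p)))) ∂μ₀ with hI
  have hIpos : 0 < I := by
    rw [hI, lintegral_pos_iff_support hm]
    have : Function.support (fun u : X ↦ ENNReal.ofReal (Real.exp (-(K * (1 + ‖u‖ ^ p)))))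
        = Set.univ := by
      ext u
      simp [Real.exp_pos]
    rw [this]
    simp
  have hItop : I ≤ 1 := by
    rw [hI]
    calc _ ≤ ∫⁻ _ : X, 1 ∂μ₀ := by
          refine lintegral_mono fun u ↦ ?_
          rw [ENNReal.ofReal_le_one, Real.exp_le_one_iff, neg_nonpos]
          positivity
      _ = 1 := by simp
  have hItop' : I ≠ ∞ := (hItop.trans_lt ENNReal.one_lt_top).ne
  refine ⟨Real.sqrt I.toReal, Real.sqrt_pos.2 (ENNReal.toReal_pos hIpos.ne' hItop'),
    fun y hy ↦ ?_⟩
  have hle : I ≤ evidence Φ μ₀ y := by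
    refine lintegral_mono fun u ↦ ENNReal.ofReal_le_ofReal (Real.exp_le_exp.2 (neg_le_neg ?_))
    exact hKup u y (by linarith [le_abs_self R])
  rw [h.evidence_eq] at hle
  rw [Real.sqrt_le_left (norm_nonneg _)]
  exact (ENNReal.le_ofReal_iff_toReal_le hItop' (by positivity)).1 hle

theorem PotentialBounds.sqrtLikelihood_ne_zero (h : PotentialBounds Φ) (y : Y) :
    h.sqrtLikelihood μ₀ y ≠ 0 := by
  obtain ⟨κ, hκ, hle⟩ := h.exists_le_norm_sqrtLikelihood (μ₀ := μ₀) ‖y‖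
  exact norm_pos_iff.1 (hκ.trans_le (hle y le_rfl))

theorem PotentialBounds.evidence_pos (h : PotentialBounds Φ) (y : Y) :
    0 < evidence Φ μ₀ y := by
  rw [h.evidence_eq, ENNReal.ofReal_pos]
  exact pow_pos (norm_pos_iff.2 (h.sqrtLikelihood_ne_zero y)) 2

theorem PotentialBounds.exists_norm_sqrtLikelihood_sub_le (h : PotentialBounds Φ) {R : ℝ}
    (hR : 0 < R) :
    ∃ L > 0, ∀ y y' : Y, ‖y‖ ≤ R → ‖y'‖ ≤ R →
      ‖h.sqrtLikelihood μ₀ y - h.sqrtLikelihood μ₀ y'‖ ≤ L * ‖y - y'‖ := by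
  obtain ⟨C, hC, hint⟩ := IsGaussian.exists_integrable_exp_sq μ₀
  obtain ⟨q, hq, hdata⟩ := h.lipschitz_data
  obtain ⟨K, hK, hlip⟩ := hdata (R + 1) (by positivity)
  -- The exponent `C/2` allowed in L² is split in two: `C/4` for the growth of `exp(-Φ/2)` and `C/4`
  -- for the factor `1 + ‖u‖ ^ q`. The radius `R + 1` turns `≤ R` into the strict inequality of the
  -- hypotheses.
  obtain ⟨M, hM⟩ := h.lower (C / 2) (by positivity) (R + 1) (by positivity)
  obtain ⟨D, hD, hpow⟩ := exists_one_add_rpow_le_exp_sq hq (b := C / 4) (by positivity)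
  have hpow' : ∀ u : X, 1 + ‖u‖ ^ q ≤ D * Real.exp (C / 4 * ‖u‖ ^ 2) := fun u ↦
    hpow ‖u‖ (norm_nonneg u)
  set B : ℝ := Real.exp (-M / 2) * (K * D)
  have hBpos : 0 < B := by positivity
  have hw : MemLp (fun u : X ↦ B * Real.exp (C / 2 * ‖u‖ ^ 2)) 2 μ₀ :=
    memLp_two_of_abs_le_exp_sq (D := B) (by fun_prop) hint fun u ↦ by
      rw [abs_of_nonneg (by positivity)]
  have hpoint : ∀ (u : X) (y y' : Y), ‖y‖ ≤ R → ‖y'‖ ≤ R →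
      |Real.exp (-Φ u y / 2) - Real.exp (-Φ u y' / 2)|
        ≤ ‖y - y'‖ * (B * Real.exp (C / 2 * ‖u‖ ^ 2)) := by
    intro u y y' hy hy'
    have hy1 : ‖y‖ < R + 1 := by linarith
    have hy1' : ‖y'‖ < R + 1 := by linarith
    have h1 := abs_exp_sub_exp_le (s := -Φ u y / 2) (t := -Φ u y' / 2)
      (m := -M / 2 + C / 4 * ‖u‖ ^ 2) (by linarith [hM u y hy1]) (by linarith [hM u y' hy1'])
    have h2 : |-Φ u y / 2 - -Φ u y' / 2| ≤ K * (1 + ‖u‖ ^ q) * ‖y - y'‖ := by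
      have h3 : -Φ u y / 2 - -Φ u y' / 2 = -(Φ u y - Φ u y') / 2 := by ring
      rw [h3, abs_div, abs_neg, abs_two]
      have h4 := hlip u y y' hy1 hy1'
      have h5 := abs_nonneg (Φ u y - Φ u y')
      linarith
    calc _ ≤ Real.exp (-M / 2 + C / 4 * ‖u‖ ^ 2) * (K * (1 + ‖u‖ ^ q) * ‖y - y'‖) :=
          h1.trans (by gcongr)
      _ ≤ Real.exp (-M / 2 + C / 4 * ‖u‖ ^ 2)
            * (K * (D * Real.exp (C / 4 * ‖u‖ ^ 2)) * ‖y - y'‖) := by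
          gcongr
          exact hpow' u
      _ = ‖y - y'‖ * (B * Real.exp (C / 2 * ‖u‖ ^ 2)) := by
          have h6 : Real.exp (C / 2 * ‖u‖ ^ 2)
              = Real.exp (C / 4 * ‖u‖ ^ 2) * Real.exp (C / 4 * ‖u‖ ^ 2) := by
            rw [← Real.exp_add]
            ring_nf
          rw [Real.exp_add, h6]
          ring
  refine ⟨‖hw.toLp _‖ + 1, by positivity, fun y y' hy hy' ↦ ?_⟩
  have hle : ‖h.sqrtLikelihood μ₀ y - h.sqrtLikelihood μ₀ y'‖ ≤ ‖y - y'‖ * ‖hw.toLp _‖ := by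
    refine Lp.norm_le_mul_norm_of_ae_le_mul ?_
    filter_upwards [Lp.coeFn_sub (h.sqrtLikelihood μ₀ y) (h.sqrtLikelihood μ₀ y'),
      h.sqrtLikelihood_ae (μ₀ := μ₀) y, h.sqrtLikelihood_ae (μ₀ := μ₀) y', hw.coeFn_toLp]
      with u h1 h2 h3 h4
    rw [h1, Pi.sub_apply, h2, h3, h4, Real.norm_eq_abs,
      Real.norm_of_nonneg (by positivity : 0 ≤ B * Real.exp (C / 2 * ‖u‖ ^ 2))]
    exact hpoint u y y' hy hy'
  calc _ ≤ ‖y - y'‖ * ‖hw.toLp _‖ := hle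
    _ ≤ _ := by nlinarith [norm_nonneg (y - y')]

/-- The square root of a posterior density is a unit vector of `L²(μ₀)`. -/
theorem PotentialBounds.hellingerDist_eq (h : PotentialBounds Φ) {y y' : Y} {μ μ' : Measure X}
    [IsFiniteMeasure μ] [IsFiniteMeasure μ'] (hμ : HasBayesDensity μ Φ μ₀ y)
    (hμ' : HasBayesDensity μ' Φ μ₀ y') :
    hellingerDist μ μ' = Real.sqrt ((1 / 2) *
      ‖‖h.sqrtLikelihood μ₀ y‖⁻¹ • h.sqrtLikelihood μ₀ y
        - ‖h.sqrtLikelihood μ₀ y'‖⁻¹ • h.sqrtLikelihood μ₀ y'‖ ^ 2) := by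
  have hsqrt : ∀ (z : Y) (u : X), Real.sqrt
      ((ENNReal.ofReal (Real.exp (-Φ u z)) / evidence Φ μ₀ z).toReal)
        = ‖h.sqrtLikelihood μ₀ z‖⁻¹ * Real.exp (-Φ u z / 2) := by
    intro z u
    rw [h.evidence_eq, ENNReal.toReal_div, ENNReal.toReal_ofReal (Real.exp_pos _).le,
      ENNReal.toReal_ofReal (by positivity), ← exp_half_sq, ← div_pow,
      Real.sqrt_sq (by positivity), div_eq_inv_mul]
  rw [BayesModelError.hellingerDist_eq hμ.1 hμ'.1, ← real_inner_self_eq_norm_sq, L2.inner_def]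
  congr 2
  refine integral_congr_ae ?_
  filter_upwards [hμ.2, hμ'.2, Lp.coeFn_sub
      (‖h.sqrtLikelihood μ₀ y‖⁻¹ • h.sqrtLikelihood μ₀ y)
      (‖h.sqrtLikelihood μ₀ y'‖⁻¹ • h.sqrtLikelihood μ₀ y'),
    Lp.coeFn_smul ‖h.sqrtLikelihood μ₀ y‖⁻¹ (h.sqrtLikelihood μ₀ y),
    Lp.coeFn_smul ‖h.sqrtLikelihood μ₀ y'‖⁻¹ (h.sqrtLikelihood μ₀ y'),
    h.sqrtLikelihood_ae (μ₀ := μ₀) y, h.sqrtLikelihood_ae (μ₀ := μ₀) y']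
    with u h1 h2 h3 h4 h5 h6 h7
  rw [h1, h2, h3, Pi.sub_apply, h4, h5, Pi.smul_apply, Pi.smul_apply, h6, h7, hsqrt, hsqrt,
    real_inner_self_eq_norm_sq, Real.norm_eq_abs, sq_abs, smul_eq_mul, smul_eq_mul]

/-- Measures with the posterior densities are locally Lipschitz in the data for the Hellinger
distance. -/
theorem PotentialBounds.exists_hellingerDist_le (h : PotentialBounds Φ) {post : Y → Measure X}
    [∀ y, IsFiniteMeasure (post y)] (hpost : ∀ y, HasBayesDensity (post y) Φ μ₀ y) {R : ℝ}
    (hR : 0 < R) :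
    ∃ C > 0, ∀ y y' : Y, ‖y‖ ≤ R → ‖y'‖ ≤ R →
      hellingerDist (post y) (post y') ≤ C * ‖y - y'‖ := by
  obtain ⟨κ, hκ, hle⟩ := h.exists_le_norm_sqrtLikelihood (μ₀ := μ₀) R
  obtain ⟨L, hL, hlip⟩ := h.exists_norm_sqrtLikelihood_sub_le (μ₀ := μ₀) hR
  refine ⟨2 * L / κ, by positivity, fun y y' hy hy' ↦ ?_⟩
  rw [h.hellingerDist_eq (hpost y) (hpost y')]
  have h1 := norm_normalize_sub_le (h.sqrtLikelihood_ne_zero (μ₀ := μ₀) y)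
    (h.sqrtLikelihood_ne_zero y')
  set N := ‖‖h.sqrtLikelihood μ₀ y‖⁻¹ • h.sqrtLikelihood μ₀ y
        - ‖h.sqrtLikelihood μ₀ y'‖⁻¹ • h.sqrtLikelihood μ₀ y'‖
  have hN : 0 ≤ N := norm_nonneg _
  calc Real.sqrt (1 / 2 * N ^ 2) ≤ Real.sqrt (N ^ 2) :=
        Real.sqrt_le_sqrt (by nlinarith [sq_nonneg N])
    _ = N := Real.sqrt_sq hN
    _ ≤ 2 * (L * ‖y - y'‖) / κ := by
        refine h1.trans ?_
        gcongr
        · exact hlip y y' hy hy'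
        · exact hle y hy
    _ = 2 * L / κ * ‖y - y'‖ := by ring

end Bounds

/-- The absolutely continuous part of `μ` is below `μ` and, having nonvanishing density, dominates
`ν`. -/
theorem absolutelyContinuous_of_rnDeriv_ne_zero {Y : Type*} [MeasurableSpace Y]
    {μ ν : Measure Y} (h : ∀ᵐ z ∂ν, μ.rnDeriv ν z ≠ 0) :
    ν ≪ μ :=
  (withDensity_absolutelyContinuous' (Measure.measurable_rnDeriv μ ν).aemeasurable h).trans
    (Measure.absolutelyContinuous_of_le (Measure.withDensity_rnDeriv_le μ ν))

/-- The case split lets a single kernel serve both conclusions: a measurable modification gives the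
a.e. formula, and under the bounds no modification is made, so the formula can hold at every data
point. -/
theorem exists_measurable_potential {X Y : Type*} [NormedAddCommGroup X]
    [SecondCountableTopology X] [MeasurableSpace X] [BorelSpace X] [NormedAddCommGroup Y]
    [SecondCountableTopology Y] [MeasurableSpace Y] [BorelSpace Y]
    {Φ : X → Y → ℝ} {ρ : Measure (X × Y)} (hΦ : AEMeasurable (fun p : X × Y ↦ Φ p.1 p.2) ρ) :
    ∃ Ψ : X → Y → ℝ, Measurable (Function.uncurry Ψ) ∧ (∀ᵐ p ∂ρ, Φ p.1 p.2 = Ψ p.1 p.2) ∧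
      (PotentialBounds Φ → Ψ = Φ) := by
  by_cases h : PotentialBounds Φ
  · exact ⟨Φ, h.continuous.measurable, ae_of_all _ fun _ ↦ rfl, fun _ ↦ rfl⟩
  · exact ⟨fun u z ↦ hΦ.mk _ (u, z), hΦ.measurable_mk, hΦ.ae_eq_mk, fun h' ↦ absurd h' h⟩

end BayesModelError

/-! ### Assembly of the main theorem. -/

theorem mainTheorem10
    {Ω X Y ι : Type*} [MeasurableSpace Ω]
    [NormedAddCommGroup X] [InnerProductSpace ℝ X] [CompleteSpace X]
    [SecondCountableTopology X] [MeasurableSpace X] [BorelSpace X]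
    [NormedAddCommGroup Y] [InnerProductSpace ℝ Y] [CompleteSpace Y]
    [SecondCountableTopology Y] [MeasurableSpace Y] [BorelSpace Y]
    (P : Measure Ω) [IsProbabilityMeasure P]
    -- the unknown `x`, the model error `ε`, the noise `η` and the data `y = G_a(x) + ε + η`
    (x : Ω → X) (ε η y : Ω → Y) (G : X → Y)
    (hx : Measurable x) (hε : Measurable ε) (hη : Measurable η) (hG : Measurable G)
    (hy : ∀ ω, y ω = G (x ω) + ε ω + η ω)
    (hgauss : HasGaussianLaw (fun ω ↦ (ε ω, x ω)) P)
    (hηgauss : HasGaussianLaw η P) (hη0 : ∫ ω, η ω ∂P = 0)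
    (hindep : IndepFun η (fun ω ↦ (ε ω, x ω)) P)
    -- commuting covariances, diagonalised by the orthonormal basis `e`
    (hcomm : Commute (BayesModelError.covOp η P) (BayesModelError.condNoiseCov x ε η P))
    (e : HilbertBasis ι ℝ Y) (lam r : ι → ℝ)
    (hlam : ∀ k, 0 < lam k) (hr : ∀ k, 0 < r k)
    (hlam_eig : ∀ k, BayesModelError.covOp η P (e k) = lam k • e k)
    (hr_eig : ∀ k, BayesModelError.condNoiseCov x ε η P (e k) = r k • e k)
    (hmean : ∀ᵐ u ∂(P.map x), Summable fun k ↦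
      (inner ℝ (G u + BayesModelError.condMean x ε P u) (e k)) ^ 2 / (lam k + r k))
    (hcov : Summable fun k ↦ (lam k - r k) ^ 2 / (lam k + r k) ^ 2)
    -- the potential: `dQ̃/dQ₀ (y) = exp (-Φ(u; y)) / c(y)`, `Q̃` the law of `y` given `x = u`
    (Φ : X → Y → ℝ) (c : Y → ℝ)
    (hΦmeas : AEMeasurable (fun p : X × Y ↦ Φ p.1 p.2) ((P.map x).prod (P.map η)))
    (hcmeas : AEMeasurable c (P.map η)) (hcpos : ∀ᵐ z ∂(P.map η), 0 < c z)
    (hΦ : ∀ᵐ u ∂(P.map x), (condDistrib y x P u).rnDeriv (P.map η)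
      =ᵐ[P.map η] fun z ↦ ENNReal.ofReal (Real.exp (-Φ u z) / c z))
    (hZ : ∀ᵐ z ∂(P.map η), 0 < BayesModelError.evidence Φ (P.map x) z) :
    -- the law of `y` given `x = u` is `N(h(u), C_{ν|x})`, absolutely continuous w.r.t. `Q₀`
    (∀ᵐ u ∂(P.map x),
      BayesModelError.IsGaussianWith (condDistrib y x P u)
        (G u + BayesModelError.condMean x ε P u) (BayesModelError.condNoiseCov x ε η P) ∧
      condDistrib y x P u ≪ P.map η) ∧
    -- the posterior
    ∃ post : Kernel Y X, IsMarkovKernel post ∧ HasCondDistrib x y post P ∧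
      (∀ᵐ z ∂(P.map y), BayesModelError.HasBayesDensity (post z) Φ (P.map x) z) ∧
      (BayesModelError.PotentialBounds Φ →
        (∀ z, BayesModelError.HasBayesDensity (post z) Φ (P.map x) z) ∧
        ∀ R > (0 : ℝ), ∃ C > (0 : ℝ), ∀ z z' : Y, ‖z‖ ≤ R → ‖z'‖ ≤ R →
          BayesModelError.hellingerDist (post z) (post z') ≤ C * ‖z - z'‖) := by
  have : IsGaussian (P.map x) := hgauss.snd.isGaussian_map
  have : IsGaussian (P.map η) := hηgauss.isGaussian_map
  have hym : Measurable y := by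
    rw [funext hy]
    exact ((hG.comp hx).add hε).add hη
  have hlaw := BayesModelError.isGaussianWith_condDistrib hx hε hη hG hy hgauss hηgauss hη0 hindep
  -- The density is positive, so the Gaussian laws are not mutually singular; by the dichotomy they
  -- are then equivalent, and the summability conditions of Feldman and Hájek are not needed.
  have hac : ∀ᵐ u ∂(P.map x), condDistrib y x P u ≪ P.map η := by
    filter_upwards [hlaw, hΦ] with u hu hΦu
    have : IsGaussian (condDistrib y x P u) := hu.1
    refine BayesModelError.absolutelyContinuous_of_absolutelyContinuous_gaussian (e := e) hr hlam
      (fun k ↦ by rw [hu.2.2, hr_eig]) (fun k ↦ by rw [BayesModelError.covOp_map_id hη, hlam_eig])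
      (BayesModelError.absolutelyContinuous_of_rnDeriv_ne_zero ?_)
    filter_upwards [hΦu, hcpos] with z hz hcz
    rw [hz]
    exact (ENNReal.ofReal_pos.2 (div_pos (Real.exp_pos _) hcz)).ne'
  refine ⟨by filter_upwards [hlaw, hac] with u h1 h2 using ⟨h1, h2⟩, ?_⟩
  obtain ⟨Ψ, hΨ, hΦΨ, hbounds⟩ := BayesModelError.exists_measurable_potential hΦmeas
  have hΦΨ₁ : ∀ᵐ u ∂(P.map x), ∀ᵐ z ∂(P.map η), Φ u z = Ψ u z := Measure.ae_ae_of_ae_prod hΦΨ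
  have hΦΨ₂ : ∀ᵐ z ∂(P.map η), ∀ᵐ u ∂(P.map x), Φ u z = Ψ u z := by
    rw [← Measure.prod_swap] at hΦΨ
    exact Measure.ae_ae_of_ae_prod (ae_of_ae_map measurable_swap.aemeasurable hΦΨ)
  have hZΨ : ∀ᵐ z ∂(P.map η), BayesModelError.evidence Φ (P.map x) z
      = BayesModelError.evidence Ψ (P.map x) z := by
    filter_upwards [hΦΨ₂] with z hz
    exact lintegral_congr_ae (hz.mono fun u hu ↦ by simp only [hu])
  -- As the inverse of a finite quantity, `d` vanishes nowhere, even where the modification of `c`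
  -- fails to be positive.
  set d : Y → ℝ≥0∞ := fun z ↦ (ENNReal.ofReal (hcmeas.mk c z))⁻¹
  have hd : Measurable d := hcmeas.measurable_mk.ennreal_ofReal.inv
  have hdensity : ∀ᵐ u ∂(P.map x), (condDistrib y x P u).rnDeriv (P.map η)
      =ᵐ[P.map η] fun z ↦ BayesModelError.likelihood Ψ u z * d z := by
    filter_upwards [hΦ, hΦΨ₁] with u hu hΨu
    filter_upwards [hu, hΨu, hcmeas.ae_eq_mk, hcpos] with z h1 h2 h3 h4
    rw [h1, ENNReal.ofReal_div_of_pos h4, h2, h3, div_eq_mul_inv]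
    rfl
  have hjoint : P.map (fun ω ↦ (x ω, y ω)) = ((P.map x).prod (P.map η)).withDensity
      fun p ↦ BayesModelError.likelihood Ψ p.1 p.2 * d p.2 := by
    rw [← compProd_map_condDistrib hym.aemeasurable]
    exact BayesModelError.compProd_eq_withDensity_prod
      (f := fun u z ↦ BayesModelError.likelihood Ψ u z * d z)
      ((BayesModelError.measurable_likelihood hΨ).mul (hd.comp measurable_snd)) hac hdensity
  have : IsProbabilityMeasure (P.map fun ω ↦ (x ω, y ω)) :=
    Measure.isProbabilityMeasure_map (hx.prodMk hym).aemeasurable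
  obtain ⟨hswap, hfin⟩ := BayesModelError.map_swap_eq_compProd_posterior (Q₀ := P.map η) hΨ hd
    (ae_of_all _ fun z ↦ ENNReal.inv_ne_zero.2 ENNReal.ofReal_ne_top)
    (by filter_upwards [hZ, hZΨ] with z h1 h2 using h2 ▸ h1) hjoint
  -- Transfers statements valid `Q₀`-a.e. to almost every data point under the law of `y`.
  have hyac : P.map y ≪ P.map η := by
    have h1 : P.map (fun ω ↦ (x ω, y ω)) ≪ (P.map x).prod (P.map η) := by
      rw [hjoint]
      exact withDensity_absolutelyContinuous _ _
    have h2 := (h1.map measurable_snd).trans Measure.quasiMeasurePreserving_snd.absolutelyContinuous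
    rwa [← Measure.snd, Measure.snd_map_prodMk hx] at h2
  refine ⟨BayesModelError.posterior (P.map x) hΨ, inferInstance,
    ⟨(hym.prodMk hx).aemeasurable, ?_⟩, ?_, fun hb ↦ ?_⟩
  · rw [Measure.snd_map_prodMk hx, Measure.map_map measurable_swap (hx.prodMk hym)] at hswap
    exact hswap
  · refine hyac.ae_le ?_
    filter_upwards [hZ, hZΨ, hfin, hΦΨ₂] with z h1 h2 h3 h4
    exact BayesModelError.hasBayesDensity_posterior hΨ h1 (h2 ▸ h3) h4
  · have hpost : ∀ z, BayesModelError.HasBayesDensity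
        (BayesModelError.posterior (P.map x) hΨ z) Φ (P.map x) z := fun z ↦
      BayesModelError.hasBayesDensity_posterior hΨ (hb.evidence_pos z) (hb.evidence_lt_top z)
        (ae_of_all _ fun u ↦ by rw [hbounds hb])
    exact ⟨hpost, fun R hR ↦ hb.exists_hellingerDist_le hpost hR⟩
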